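/- **Conventions.** Additive groups are abelian. For a finite multiset $A$, $|A|$ and $\mathbb{E}_{a\in A}F(a)=\frac1{|A|}\sum_{a\in A}F(a)$ count multiplicity, and $A+B$ is the multiset of all sums $a+b$ ($a\in A$, $b\in B$), so $|A+B|=|A||B|$. A *coset progression* of rank $\rho\ge 0$ in an additive group $G$ is a finite multiset of the form $$Q=H+\{n_1v_1+\dots+n_\rho v_\rho : n\in\mathbb{Z}^\rho,\ |n_s|\le N_s\ \forall s\},$$ given together with its data: a finite subgroup $H\le G$ (viewed as a multiset in which all elements have the same positive multiplicity), $v_1,\dots,v_\rho\in G$, and real numbers $N_1,\dots,N_\rho>0$; the sums are counted with multiplicity. For $\varepsilon>0$, its dilate is $$\varepsilon Q=H+\{n_1v_1+\dots+n_\rho v_\rho : n\in\mathbb{Z}^\rho,\ |n_s|\le \varepsilon N_s\ \forall s\}.$$ For an at most countable additive group $G$, a *$G$-system* is a probability space $\mathrm{X}=(X,\mathcal{B},\mu)$, countably generated modulo null sets, with invertible measure-preserving maps $T^g:X\to X$ $(g\in G)$ such that $T^0=\mathrm{id}$ and $T^{g+h}=T^gT^h$. Put $T^gf=f\circ T^{-g}$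 and $\Delta_{h,h'}f=(T^hf)\,\overline{(T^{h'}f)}$. For $m\ge1$, non-empty finite multisets $Q_1,\dots,Q_m$ in $G$ and $f\in L^\infty(\mathrm{X})$ (complex-valued), the Gowers box seminorm $\|f\|_{\Box^m_{Q_1,\dots,Q_m}(\mathrm{X})}\ge 0$ is defined by $$\|f\|_{\Box^m_{Q_1,\dots,Q_m}(\mathrm{X})}^{2^m}=\mathbb{E}_{h_i,h_i'\in Q_i\ \forall i=1,\dots,m}\int_X\Delta_{h_1,h_1'}\cdots\Delta_{h_m,h_m'}f\,d\mu,$$ which does not depend on the order of the $Q_i$. **Theorem.** For every integer $d\ge 1$ and every integer $r\ge 0$ there is a function $c:(0,\infty)\to(0,\infty)$, depending only on $r$ and $d$, with $c(\varepsilon)\to0$ as $\varepsilon\to0$, such that the following holds. Let $G$ be an at most countable additive group, let $\mathrm{X}$ be a $G$-system, let $I$ be a finite non-empty set, and for $i\in I$ and $1\le k\le d$ let $Q_{i,k}$ be a coset progression in $G$ of rank at most $r$. Let $f\in L^\infty(\mathrm{X})$ with $\|f\|_{L^\infty(\mathrm{X})}\le 1$. If $$\frac1{|I|^2}\sum_{i,j\in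 I}\|f\|_{\Box^{d^2}_{(\varepsilon Q_{i,k}+\varepsilon Q_{j,l})_{1\le k\le d,\,1\le l\le d}}(\mathrm{X})}\le\varepsilon$$ for some $\varepsilon>0$, then $$\frac1{|I|}\sum_{i\in I}\|f\|_{\Box^{d}_{Q_{i,1},\dots,Q_{i,d}}(\mathrm{X})}\le c(\varepsilon).$$ -/

import Mathlib

open MeasureTheory Filter Topology BigOperators

noncomputable section

/-- The average of `F` over a finite multiset, counting multiplicity. -/
def multisetAvg {G : Type*} (A : Multiset G) (F : G → ℂ) : ℂ :=
  (A.map F).sum / (A.card : ℂ)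

/-- The sumset of two finite multisets, counting multiplicity (so `|A + B| = |A| |B|`; this is not
Mathlib's `A + B`, which is the disjoint union). -/
def sumset {G : Type*} [AddCommGroup G] (A B : Multiset G) : Multiset G :=
  (A ×ˢ B).map fun p => p.1 + p.2

/-- The integer vectors `(n_1, …, n_r)` with `|n_i| ≤ N_i` for all `i`; see `mem_intBox`. -/
def intBox {r : ℕ} (N : Fin r → ℝ) : Finset (Fin r → ℤ) :=
  Fintype.piFinset fun i => Finset.Icc (-⌊N i⌋) ⌊N i⌋

theorem mem_intBox {r : ℕ} (N : Fin r → ℝ) (n : Fin r → ℤ) :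
    n ∈ intBox N ↔ ∀ i, |(n i : ℝ)| ≤ N i := by
  simp only [intBox, Fintype.mem_piFinset, Finset.mem_Icc]
  refine forall_congr' fun i => ?_
  rw [← abs_le, Int.le_floor]
  push_cast
  rfl

/-- A (symmetric) coset progression
`H + {n_1 v_1 + ⋯ + n_r v_r : |n_i| ≤ N_i}`, recorded by its data.  The finite subgroup `H` is
regarded as a multiset in which every element has the same positive multiplicity `mult`. -/
structure CosetProgression (G : Type*) [AddCommGroup G] where
  /-- the finite subgroup -/
  H : AddSubgroup G
  finite_H : (H : Set G).Finite
  /-- the common multiplicity of the elements of `H` -/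
  mult : ℕ
  mult_pos : 0 < mult
  /-- the rank `r` -/
  rank : ℕ
  /-- the generators `v_1, …, v_r` -/
  v : Fin rank → G
  /-- the dimensions `N_1, …, N_r` -/
  N : Fin rank → ℝ
  N_pos : ∀ i, 0 < N i

namespace CosetProgression

variable {G : Type*} [AddCommGroup G]

/-- The dilate `εQ = H + {n_1 v_1 + ⋯ + n_r v_r : |n_i| ≤ ε N_i}` as a finite multiset, the sums
being counted with multiplicity. -/
def dilate (ε : ℝ) (Q : CosetProgression G) : Multiset G :=
  sumset (Q.mult • Q.finite_H.toFinset.val)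
    ((intBox fun i => ε * Q.N i).val.map fun n => ∑ i, n i • Q.v i)

/-- The finite multiset underlying a coset progression. -/
def toMultiset (Q : CosetProgression G) : Multiset G :=
  sumset (Q.mult • Q.finite_H.toFinset.val)
    ((intBox Q.N).val.map fun n => ∑ i, n i • Q.v i)

end CosetProgression

/-- The probability space `(X, μ)` is countably generated modulo null sets: up to null sets, every
measurable set lies in the σ-algebra generated by countably many measurable sets. -/
def CountablyGeneratedModNull {X : Type*} [MeasurableSpace X] (μ : Measure X) : Prop :=
  ∃ S : Set (Set X), S.Countable ∧ (∀ s ∈ S, MeasurableSet s) ∧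
    ∀ A : Set X, MeasurableSet A →
      ∃ B : Set X, MeasurableSet[MeasurableSpace.generateFrom S] B ∧ A =ᵐ[μ] B

/-- `(X, μ)`, with the maps `T^g x = g +ᵥ x`, is a `G`-system: a probability space that is countably
generated modulo null sets, on which every `T^g` is measure-preserving.  The laws `T^0 = id` and
`T^(g+h) = T^g T^h`, and with them the invertibility of `T^g`, are those of `AddAction`. -/
structure IsGSystem (G : Type*) {X : Type*} [AddCommGroup G] [AddAction G X] [MeasurableSpace X]
    (μ : Measure X) : Prop where
  isProbabilityMeasure : IsProbabilityMeasure μ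
  measurePreserving : ∀ g : G, MeasurePreserving (fun x : X => g +ᵥ x) μ μ
  countablyGenerated : CountablyGeneratedModNull μ

section Gowers

variable {G X : Type*} [AddCommGroup G] [AddAction G X]

/-- `T^g f = f ∘ T^(-g)`. -/
def shift (g : G) (f : X → ℂ) : X → ℂ := fun x => f (-g +ᵥ x)

/-- `Δ_{h,h'} f = (T^h f) · conj (T^h' f)`. -/
def gowersDelta (h h' : G) (f : X → ℂ) : X → ℂ :=
  fun x => shift h f x * (starRingEnd ℂ) (shift h' f x)

/-- The operators `Δ` commute, so the order of the multisets is irrelevant below. -/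
theorem gowersDelta_comm (h h' k k' : G) (f : X → ℂ) :
    gowersDelta h h' (gowersDelta k k' f) = gowersDelta k k' (gowersDelta h h' f) := by
  funext x
  simp only [gowersDelta, shift, vadd_vadd, map_mul, Complex.conj_conj,
    add_comm (-h) , add_comm (-h')]
  ring

variable [MeasurableSpace X]

/-- For multisets `Q_1, …, Q_d`, the average over `h_i, h'_i ∈ Q_i` (`1 ≤ i ≤ d`) of
`∫ Δ_{h_1,h'_1} ⋯ Δ_{h_d,h'_d} f dμ`. -/
def boxAvg (μ : Measure X) : List (Multiset G) → (X → ℂ) → ℂ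
  | [], f => ∫ x, f x ∂μ
  | Q :: Qs, f => multisetAvg Q fun h => multisetAvg Q fun h' => boxAvg μ Qs (gowersDelta h h' f)

/-- The Gowers box norm `‖f‖_{□^d_{Q_1,…,Q_d}}` for a list `Q_1, …, Q_d` of multisets: the
`2^d`-th root of `boxAvg`, which for `d ≥ 1` and bounded `f` on a `G`-system is a non-negative real
number (see `IsGSystem.boxNorm_pow`). -/
def boxNorm (μ : Measure X) (Qs : List (Multiset G)) (f : X → ℂ) : ℝ :=
  ‖boxAvg μ Qs f‖ ^ ((1 : ℝ) / 2 ^ Qs.length)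

theorem multisetAvg_nonneg {G : Type*} (A : Multiset G) (F : G → ℂ)
    (hF : ∀ h, ∃ a : ℝ, 0 ≤ a ∧ F h = a) : ∃ a : ℝ, 0 ≤ a ∧ multisetAvg A F = a := by
  choose b hb hF using hF
  refine ⟨(A.map b).sum / A.card, div_nonneg (Multiset.sum_nonneg ?_) (Nat.cast_nonneg _), ?_⟩
  · intro x hx
    obtain ⟨g, _, rfl⟩ := Multiset.mem_map.1 hx
    exact hb g
  · obtain rfl : F = fun h => (b h : ℂ) := funext hF
    have : (A.map fun h => (b h : ℂ)).sum = ((A.map b).sum : ℝ) := by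
      induction A using Multiset.induction_on with
      | empty => simp
      | cons a s ih => simp [ih]
    simp [multisetAvg, this]

theorem integral_multiset_map_sum {G X : Type*} [MeasurableSpace X] {μ : Measure X}
    (A : Multiset G) (F : G → X → ℂ) (hF : ∀ h, Integrable (F h) μ) :
    Integrable (fun x => (A.map fun h => F h x).sum) μ ∧
      ∫ x, (A.map fun h => F h x).sum ∂μ = (A.map fun h => ∫ x, F h x ∂μ).sum := by
  induction A using Multiset.induction_on with
  | empty => simp
  | cons a s ih =>
    simp only [Multiset.map_cons, Multiset.sum_cons]
    exact ⟨(hF a).add ih.1, by rw [integral_add (hF a) ih.1, ih.2]⟩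

theorem IsGSystem.memLp_gowersDelta {μ : Measure X} (hμ : IsGSystem G μ) (h h' : G) {f : X → ℂ}
    (hf : MemLp f ⊤ μ) : MemLp (gowersDelta h h' f) ⊤ μ := by
  have hs : ∀ g : G, MemLp (shift g f) ⊤ μ := fun g =>
    hf.comp_measurePreserving (hμ.measurePreserving (-g))
  exact (hs h').star.mul (hs h)

theorem IsGSystem.boxAvg_nonneg {μ : Measure X} (hμ : IsGSystem G μ) (Q : Multiset G)
    (Qs : List (Multiset G)) {f : X → ℂ} (hf : MemLp f ⊤ μ) :
    ∃ a : ℝ, 0 ≤ a ∧ boxAvg μ (Q :: Qs) f = a := by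
  have := hμ.isProbabilityMeasure
  induction Qs generalizing Q f with
  | nil =>
    have hi : ∀ h h' : G, Integrable (gowersDelta h h' f) μ := fun h h' =>
      (hμ.memLp_gowersDelta h h' hf).integrable le_top
    refine ⟨(∫ x, ‖(Q.map fun h => shift h f x).sum‖ ^ 2 ∂μ) / (Q.card * Q.card),
      by positivity, ?_⟩
    have key : (Q.map fun h => (Q.map fun h' => ∫ x, gowersDelta h h' f x ∂μ).sum).sum =
        ((∫ x, ‖(Q.map fun h => shift h f x).sum‖ ^ 2 ∂μ : ℝ) : ℂ) := by
      simp_rw [← (integral_multiset_map_sum Q _ (hi _)).2]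
      rw [← (integral_multiset_map_sum Q _
        fun h => (integral_multiset_map_sum Q _ (hi h)).1).2, ← integral_complex_ofReal]
      refine integral_congr_ae (Eventually.of_forall fun x => ?_)
      simp only [gowersDelta, Multiset.sum_map_mul_left, Multiset.sum_map_mul_right]
      rw [Complex.ofReal_pow, ← Complex.mul_conj', map_multiset_sum, Multiset.map_map]
      rfl
    simp only [boxAvg, multisetAvg, Multiset.sum_map_div]
    rw [key]
    push_cast
    rw [div_div]
  | cons R Rs ih =>
    exact multisetAvg_nonneg _ _ fun h => multisetAvg_nonneg _ _ fun h' =>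
      ih R (hμ.memLp_gowersDelta h h' hf)

/-- The defining identity `‖f‖_{□^d}^(2^d) = E ∫ Δ ⋯ Δ f dμ` for `d ≥ 1`. -/
theorem IsGSystem.boxNorm_pow {μ : Measure X} (hμ : IsGSystem G μ) (Qs : List (Multiset G))
    (hQs : Qs ≠ []) {f : X → ℂ} (hf : MemLp f ⊤ μ) :
    ((boxNorm μ Qs f : ℝ) : ℂ) ^ 2 ^ Qs.length = boxAvg μ Qs f := by
  obtain ⟨Q, Rs, rfl⟩ := List.exists_cons_of_ne_nil hQs
  obtain ⟨a, ha, h⟩ := hμ.boxAvg_nonneg Q Rs hf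
  rw [boxNorm, h, ← Complex.ofReal_pow, ← Real.rpow_natCast, ← Real.rpow_mul (norm_nonneg _)]
  simp [abs_of_nonneg ha]

end Gowers

end

noncomputable section

/-! ### Averages -/

/-! Call a function structured along sets `A k` (`IsStr`) if its translate by `-∑ k, e k`, with `e k
∈ A k`, is nearly a bounded combination of products of functions each of which ignores one `e k`. By
Cauchy–Schwarz (`norm_piAvg_pow_le_boxAvg`), the correlation of `f` with a structured function is
controlled by a box norm of `f` (`IsStr.norm_integral_mul_le`). Conversely, a box norm is the
correlation of `f` with its dual function (`boxAvg_eq_integral_mul_boxDual`), which is structured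
along small dilates, because averages over a coset progression hardly change under translation by
elements of a small dilate. The decisive fact is `IsStr.boxDual_add`: the dual function along `Q i`
of a function structured along `Q j` is structured along all the sums of `Q i` and `Q j`.

The heart is a Bessel argument. Let `P_i` be, heuristically, the projection to functions structured
along `Q i`. If the `d`-fold box norms are large on average, then so is the average of `⟨f, P_i f⟩`.
As `f` does not depend on `i`, Cauchy–Schwarz makes the average of `⟨P_i f, P_j f⟩ = ⟨f, P_i P_j f⟩`
large. But `P_i P_j f` is structured along the sums of `Q i` and `Q j`, so the `d²`-fold box norms
cannot be small on average.

There are no exact projections. They are replaced by bounded approximants whose error is almost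
orthogonal to all functions of far greater complexity, found by an energy decrement
(`exists_bounded_approx`). It yields `φ i` in place of `P_i f` and, through
`exists_approx_of_isStr`, `g i j` in place of `P_i P_j f`; `le_norm_expect_expect_integral` does the
Hilbert space computation with them. In the search for `φ` each decrement step shrinks the
progressions by a factor `τ`. The number of steps is bounded in advance by some `N`, so with `τ ^ (N
+ 1) = ε` no scale falls below `ε` (`exists_threshold`). -/

theorem norm_expect_le {ι : Type*} (s : Finset ι) (f : ι → ℂ) :
    ‖𝔼 i ∈ s, f i‖ ≤ 𝔼 i ∈ s, ‖f i‖ := by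
  rw [Finset.expect_eq_sum_div_card, Finset.expect_eq_sum_div_card, norm_div, Complex.norm_natCast]
  gcongr
  exact norm_sum_le _ _

theorem norm_expect_le_of_le {ι : Type*} [Fintype ι] (f : ι → ℂ) {δ : ℝ} (hδ : 0 ≤ δ)
    (h : ∀ i, ‖f i‖ ≤ δ) : ‖𝔼 i, f i‖ ≤ δ := by
  refine (norm_expect_le _ _).trans ?_
  rcases isEmpty_or_nonempty ι with hi | hi
  · simpa using hδ
  · exact Finset.expect_le Finset.univ_nonempty fun i _ => h i

theorem expect_pow_le_expect_pow {ι : Type*} [Fintype ι] [Nonempty ι] (f : ι → ℝ)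
    (hf : ∀ i, 0 ≤ f i) (n : ℕ) : (𝔼 i, f i) ^ n ≤ 𝔼 i, f i ^ n := by
  have hc : (0 : ℝ) < Fintype.card ι := by exact_mod_cast Fintype.card_pos
  have := Real.pow_arith_mean_le_arith_mean_pow Finset.univ
    (fun _ : ι => (Fintype.card ι : ℝ)⁻¹) f (fun _ _ => by positivity)
    (by simp [hc.ne']) (fun i _ => hf i) n
  simpa only [Fintype.expect_eq_sum_div_card, div_eq_inv_mul, Finset.mul_sum] using this

theorem ofReal_expect {ι : Type*} (s : Finset ι) (f : ι → ℝ) :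
    ((𝔼 i ∈ s, f i : ℝ) : ℂ) = 𝔼 i ∈ s, (f i : ℂ) := by
  simp [Finset.expect_eq_sum_div_card]

theorem conj_expect {ι : Type*} (s : Finset ι) (f : ι → ℂ) :
    (starRingEnd ℂ) (𝔼 i ∈ s, f i) = 𝔼 i ∈ s, (starRingEnd ℂ) (f i) := by
  simp [Finset.expect_eq_sum_div_card, map_sum]

theorem re_expect {ι : Type*} (s : Finset ι) (f : ι → ℂ) :
    (𝔼 i ∈ s, f i).re = 𝔼 i ∈ s, (f i).re := by
  simp [Finset.expect_eq_sum_div_card]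

/-! ### Averages over multisets and over tuples -/

section Multiset

variable {G : Type*}

/-- The elements of a multiset, enumerated with multiplicity. -/
def Multiset.enum (A : Multiset G) (t : Fin A.toList.length) : G := A.toList[t]

theorem Multiset.enum_mem (A : Multiset G) (t : Fin A.toList.length) : A.enum t ∈ A := by
  rw [← Multiset.mem_toList]
  exact List.getElem_mem _

theorem Multiset.nonempty_fin_of_ne_zero {A : Multiset G} (hA : A ≠ 0) :
    Nonempty (Fin A.toList.length) := by
  rw [← Fin.pos_iff_nonempty, Multiset.length_toList]
  exact Multiset.card_pos.2 hA

theorem multisetAvg_eq_expect (A : Multiset G) (F : G → ℂ) :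
    multisetAvg A F = 𝔼 t, F (A.enum t) := by
  rw [multisetAvg, Fintype.expect_eq_sum_div_card, Fintype.card_fin,
    ← Multiset.length_toList A]
  congr 1
  conv_lhs => rw [← Multiset.coe_toList A, Multiset.map_coe, Multiset.sum_coe]
  simp only [Multiset.enum]
  exact (Fin.sum_univ_fun_getElem A.toList F).symm

theorem norm_multisetAvg_le (A : Multiset G) (F : G → ℂ) {δ : ℝ} (hδ : 0 ≤ δ)
    (h : ∀ a ∈ A, ‖F a‖ ≤ δ) : ‖multisetAvg A F‖ ≤ δ := by
  rw [multisetAvg_eq_expect]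
  exact norm_expect_le_of_le _ hδ fun t => h _ (A.enum_mem t)

theorem multisetAvg_sub (A : Multiset G) (F F' : G → ℂ) :
    multisetAvg A (fun a => F a - F' a) = multisetAvg A F - multisetAvg A F' := by
  simp only [multisetAvg_eq_expect, Finset.expect_sub_distrib]

/-- The average over all tuples with `k`-th entry in `A k`, counting multiplicity. -/
def piAvg {n : ℕ} (A : Fin n → Multiset G) (Φ : (Fin n → G) → ℂ) : ℂ :=
  𝔼 t : ∀ k, Fin (A k).toList.length, Φ fun k => (A k).enum (t k)

theorem piAvg_eq {n : ℕ} (A : Fin n → Multiset G) (Φ : (Fin n → G) → ℂ) :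
    piAvg A Φ = 𝔼 t : ∀ k, Fin (A k).toList.length, Φ fun k => (A k).enum (t k) := rfl

theorem piAvg_zero (A : Fin 0 → Multiset G) (Φ : (Fin 0 → G) → ℂ) :
    piAvg A Φ = Φ Fin.elim0 := by
  simp only [piAvg]
  rw [← Fintype.expect_const (ι := ∀ k, Fin (A k).toList.length) (Φ Fin.elim0)]
  exact Finset.expect_congr rfl fun t _ => congrArg Φ (Subsingleton.elim _ _)

theorem piAvg_succ {n : ℕ} (A : Fin (n + 1) → Multiset G) (Φ : (Fin (n + 1) → G) → ℂ) :
    piAvg A Φ = multisetAvg (A 0) fun a =>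
      piAvg (fun k => A k.succ) fun h => Φ (Fin.cons a h) := by
  simp only [piAvg, multisetAvg_eq_expect]
  rw [← Finset.expect_product', Finset.univ_product_univ]
  refine (Fintype.expect_equiv (Fin.consEquiv _) _ _ fun p => ?_).symm
  congr 1
  funext k
  refine Fin.cases ?_ (fun k => ?_) k <;> simp [Fin.consEquiv]

theorem norm_piAvg_le {n : ℕ} (A : Fin n → Multiset G) (Φ : (Fin n → G) → ℂ) {δ : ℝ} (hδ : 0 ≤ δ)
    (h : ∀ e, (∀ k, e k ∈ A k) → ‖Φ e‖ ≤ δ) : ‖piAvg A Φ‖ ≤ δ :=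
  norm_expect_le_of_le _ hδ fun t => h _ fun k => (A k).enum_mem (t k)

theorem piAvg_sub {n : ℕ} (A : Fin n → Multiset G) (Φ Φ' : (Fin n → G) → ℂ) :
    piAvg A (fun e => Φ e - Φ' e) = piAvg A Φ - piAvg A Φ' := by
  simp only [piAvg, Finset.expect_sub_distrib]

theorem piAvg_const {n : ℕ} {A : Fin n → Multiset G} (hA : ∀ k, A k ≠ 0) (z : ℂ) :
    piAvg A (fun _ => z) = z := by
  have := fun k => Multiset.nonempty_fin_of_ne_zero (hA k)
  exact Fintype.expect_const z

end Multiset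

/-! ### Almost invariance of averages under translation -/

section ShiftInv

variable {G : Type*} [AddCommGroup G]

/-- Averages over `A` of functions bounded by `1` change by at most `δ` under translation by `e`. -/
def ShiftInv (A : Multiset G) (e : G) (δ : ℝ) : Prop :=
  ∀ φ : G → ℂ, (∀ g, ‖φ g‖ ≤ 1) →
    ‖multisetAvg A (fun a => φ (a + e)) - multisetAvg A φ‖ ≤ δ

theorem ShiftInv.zero (A : Multiset G) : ShiftInv A 0 0 := by
  intro φ _
  simp

theorem ShiftInv.add {A : Multiset G} {e e' : G} {δ δ' : ℝ} (h : ShiftInv A e δ)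
    (h' : ShiftInv A e' δ') : ShiftInv A (e + e') (δ + δ') := by
  intro φ hφ
  have h1 := h (fun g => φ (g + e')) fun g => hφ _
  have h2 := h' φ hφ
  simp only [add_assoc] at h1
  calc _ = ‖(multisetAvg A (fun a => φ (a + (e + e'))) - multisetAvg A fun a => φ (a + e')) +
        (multisetAvg A (fun a => φ (a + e')) - multisetAvg A φ)‖ := by ring_nf
    _ ≤ _ := (norm_add_le _ _).trans (add_le_add h1 h2)

theorem ShiftInv.sum {A : Multiset G} {κ : Type*} (s : Finset κ) {e : κ → G} {δ : ℝ}
    (h : ∀ k ∈ s, ShiftInv A (e k) δ) : ShiftInv A (∑ k ∈ s, e k) (s.card * δ) := by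
  classical
  induction s using Finset.induction_on with
  | empty => simpa using ShiftInv.zero A
  | insert k s hk ih =>
    rw [Finset.sum_insert hk, Finset.card_insert_of_notMem hk]
    have := (h k (Finset.mem_insert_self _ _)).add
      (ih fun l hl => h l (Finset.mem_insert_of_mem hl))
    convert this using 1
    push_cast
    ring

/-- The coordinates are translated one at a time, each at the cost `δ`. -/
theorem ShiftInv.piAvg {n : ℕ} {A : Fin n → Multiset G} {e : Fin n → G} {δ : ℝ} (hδ : 0 ≤ δ)
    (h : ∀ k, ShiftInv (A k) (e k) δ) {Φ : (Fin n → G) → ℂ} (hΦ : ∀ g, ‖Φ g‖ ≤ 1) :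
    ‖piAvg A (fun g => Φ (g + e)) - piAvg A Φ‖ ≤ n * δ := by
  induction n with
  | zero =>
    rw [piAvg_zero, piAvg_zero, Subsingleton.elim (Fin.elim0 + e) Fin.elim0]
    simp
  | succ n ih =>
    rw [piAvg_succ, piAvg_succ]
    have key : ∀ (a : G) (g : Fin n → G),
        (Fin.cons a g : Fin (n + 1) → G) + e = Fin.cons (a + e 0) (g + fun k => e k.succ) := by
      intro a g
      funext k
      refine Fin.cases ?_ (fun k => ?_) k <;> simp
    simp only [key]
    let ψ : G → ℂ := fun a => _root_.piAvg (fun k => A k.succ) fun g => Φ (Fin.cons a g)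
    let χ : G → ℂ := fun a => _root_.piAvg (fun k => A k.succ)
      fun g => Φ (Fin.cons a (g + fun k => e k.succ))
    have h1 : ∀ a, ‖χ a - ψ a‖ ≤ n * δ := fun a =>
      ih (A := fun k => A k.succ) (e := fun k => e k.succ) (fun k => h k.succ)
        (Φ := fun g => Φ (Fin.cons a g)) fun g => hΦ _
    have h2 := h 0 ψ fun a => norm_piAvg_le _ _ zero_le_one fun g _ => hΦ _
    have h3 := norm_multisetAvg_le (A 0) (fun a => χ (a + e 0) - ψ (a + e 0))
      (δ := n * δ) (by positivity) fun a _ => h1 _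
    rw [multisetAvg_sub] at h3
    change ‖multisetAvg (A 0) (fun a => χ (a + e 0)) - multisetAvg (A 0) ψ‖ ≤ _
    refine (norm_sub_le_norm_sub_add_norm_sub _ (multisetAvg (A 0) fun a => ψ (a + e 0)) _).trans ?_
    push_cast
    linarith

end ShiftInv

/-! ### Bounded functions and Cauchy–Schwarz -/

section UnitBdd

variable {X : Type*} [MeasurableSpace X]

/-- Measurable functions bounded by `1` everywhere. -/
structure UnitBdd (f : X → ℂ) : Prop where
  measurable : Measurable f
  norm_le : ∀ x, ‖f x‖ ≤ 1

namespace UnitBdd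

variable {f g : X → ℂ}

theorem one : UnitBdd (fun _ : X => (1 : ℂ)) := ⟨measurable_const, fun _ => by simp⟩

theorem mul (hf : UnitBdd f) (hg : UnitBdd g) : UnitBdd fun x => f x * g x :=
  ⟨hf.measurable.mul hg.measurable, fun x => by
    rw [norm_mul]
    exact mul_le_one₀ (hf.norm_le x) (norm_nonneg _) (hg.norm_le x)⟩

theorem conj (hf : UnitBdd f) : UnitBdd fun x => (starRingEnd ℂ) (f x) :=
  ⟨Complex.continuous_conj.measurable.comp hf.measurable, fun x => by
    rw [RCLike.norm_conj]; exact hf.norm_le x⟩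

theorem prod {ι : Type*} (s : Finset ι) {f : ι → X → ℂ} (hf : ∀ i ∈ s, UnitBdd (f i)) :
    UnitBdd fun x => ∏ i ∈ s, f i x :=
  ⟨Finset.measurable_fun_prod s fun i hi => (hf i hi).measurable, fun x => by
    rw [norm_prod]
    exact Finset.prod_le_one (fun _ _ => norm_nonneg _) fun i hi => (hf i hi).norm_le x⟩

theorem expect {ι : Type*} [Fintype ι] {f : ι → X → ℂ} (hf : ∀ i, UnitBdd (f i)) :
    UnitBdd fun x => 𝔼 i, f i x :=
  ⟨by
    simp only [Fintype.expect_eq_sum_div_card]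
    exact (Finset.measurable_fun_sum _ fun i _ => (hf i).measurable).div_const _,
   fun x => norm_expect_le_of_le _ zero_le_one fun i => (hf i).norm_le x⟩

theorem piAvg {G : Type*} {n : ℕ} (A : Fin n → Multiset G) {f : (Fin n → G) → X → ℂ}
    (hf : ∀ e, UnitBdd (f e)) : UnitBdd fun x => _root_.piAvg A fun e => f e x :=
  UnitBdd.expect fun _ => hf _

theorem memLp (hf : UnitBdd f) (μ : Measure X) : MemLp f ⊤ μ :=
  memLp_top_of_bound hf.measurable.aestronglyMeasurable 1 (Eventually.of_forall hf.norm_le)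

theorem integrable (hf : UnitBdd f) (μ : Measure X) [IsFiniteMeasure μ] : Integrable f μ :=
  (hf.memLp μ).integrable le_top

theorem norm_integral_le (hf : UnitBdd f) (μ : Measure X) [IsProbabilityMeasure μ] :
    ‖∫ x, f x ∂μ‖ ≤ 1 := by
  simpa using norm_integral_le_of_norm_le_const (μ := μ) (Eventually.of_forall hf.norm_le)

end UnitBdd

theorem integral_expect {ι : Type*} [Fintype ι] {μ : Measure X} {F : ι → X → ℂ}
    (hF : ∀ i, Integrable (F i) μ) : ∫ x, 𝔼 i, F i x ∂μ = 𝔼 i, ∫ x, F i x ∂μ := by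
  simp only [Fintype.expect_eq_sum_div_card]
  rw [integral_div, integral_finsetSum _ fun i _ => hF i]

theorem norm_integral_sq_le {μ : Measure X} [IsProbabilityMeasure μ] {b W : X → ℂ}
    (hb : UnitBdd b) (hW : UnitBdd W) :
    ‖∫ x, b x * W x ∂μ‖ ^ 2 ≤ ∫ x, ‖W x‖ ^ 2 ∂μ := by
  have hi : Integrable (fun x => ‖W x‖) μ := (hW.integrable μ).norm
  have hi2 : Integrable (fun x => ‖W x‖ ^ 2) μ := by
    simpa [pow_two] using ((hW.mul hW).integrable μ).norm
  have h1 : ‖∫ x, b x * W x ∂μ‖ ≤ ∫ x, ‖W x‖ ∂μ := by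
    refine (norm_integral_le_integral_norm _).trans
      (integral_mono ((hb.mul hW).integrable μ).norm hi fun x => ?_)
    simpa using mul_le_mul_of_nonneg_right (hb.norm_le x) (norm_nonneg (W x))
  set c := ∫ x, ‖W x‖ ∂μ with hc
  have h2 : 0 ≤ ∫ x, (‖W x‖ ^ 2 - 2 * c * ‖W x‖ + c ^ 2) ∂μ :=
    integral_nonneg fun x => by
      have := sq_nonneg (‖W x‖ - c)
      simp only [Pi.zero_apply]
      linarith
  have hs : Integrable (fun x => ‖W x‖ ^ 2 - 2 * c * ‖W x‖) μ := hi2.sub (hi.const_mul _)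
  rw [integral_add hs (integrable_const _), integral_sub hi2 (hi.const_mul _),
    integral_const_mul, ← hc] at h2
  simp only [integral_const, probReal_univ, one_smul] at h2
  have h3 : ‖∫ x, b x * W x ∂μ‖ ^ 2 ≤ c ^ 2 := pow_le_pow_left₀ (norm_nonneg _) h1 2
  linarith

/-- Cauchy–Schwarz in `(t, x)`: the weight `b`, which does not depend on `s`, disappears and `s` is
doubled. Taking `S` or `T` to be a point gives the two Hilbert space inequalities of the Bessel
argument. -/
theorem norm_expect_integral_sq_le {μ : Measure X} [IsProbabilityMeasure μ] {S T : Type*} [Fintype S]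
    [Fintype T] [Nonempty T] {b : T → X → ℂ} {Z : S → T → X → ℂ}
    (hb : ∀ t, UnitBdd (b t)) (hZ : ∀ s t, UnitBdd (Z s t)) :
    ‖𝔼 s, 𝔼 t, ∫ x, b t x * Z s t x ∂μ‖ ^ 2 ≤
      ‖𝔼 s, 𝔼 s', 𝔼 t, ∫ x, Z s t x * (starRingEnd ℂ) (Z s' t x) ∂μ‖ := by
  have hW : ∀ t, UnitBdd fun x => 𝔼 s, Z s t x := fun t => UnitBdd.expect fun s => hZ s t
  have e1 : 𝔼 s, 𝔼 t, ∫ x, b t x * Z s t x ∂μ = 𝔼 t, ∫ x, b t x * 𝔼 s, Z s t x ∂μ := by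
    rw [Finset.expect_comm]
    refine Finset.expect_congr rfl fun t _ => ?_
    simp_rw [Finset.mul_expect]
    exact (integral_expect fun s => ((hb t).mul (hZ s t)).integrable μ).symm
  have e2 : 𝔼 s, 𝔼 s', 𝔼 t, ∫ x, Z s t x * (starRingEnd ℂ) (Z s' t x) ∂μ =
      ((𝔼 t, ∫ x, ‖𝔼 s, Z s t x‖ ^ 2 ∂μ : ℝ) : ℂ) := by
    rw [ofReal_expect]
    simp_rw [Finset.expect_comm (t := (Finset.univ : Finset T))]
    refine Finset.expect_congr rfl fun t _ => ?_
    rw [← integral_complex_ofReal]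
    simp_rw [Complex.ofReal_pow, ← Complex.mul_conj', conj_expect, Finset.expect_mul,
      Finset.mul_expect]
    rw [integral_expect fun s => (UnitBdd.expect fun s' => (hZ s t).mul (hZ s' t).conj).integrable μ]
    refine Finset.expect_congr rfl fun s _ => ?_
    rw [integral_expect fun s' => ((hZ s t).mul (hZ s' t).conj).integrable μ]
  rw [e1, e2, Complex.norm_real, Real.norm_of_nonneg
    (Finset.expect_nonneg fun t _ => integral_nonneg fun x => by positivity)]
  calc _ ≤ (𝔼 t, ‖∫ x, b t x * 𝔼 s, Z s t x ∂μ‖) ^ 2 :=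
        pow_le_pow_left₀ (norm_nonneg _) (norm_expect_le _ _) 2
    _ ≤ 𝔼 t, ‖∫ x, b t x * 𝔼 s, Z s t x ∂μ‖ ^ 2 :=
        expect_pow_le_expect_pow _ (fun _ => norm_nonneg _) 2
    _ ≤ _ := Finset.expect_le_expect fun t _ => norm_integral_sq_le (hb t) (hW t)

end UnitBdd

/-! ### Box Cauchy–Schwarz inequality and dual functions -/

section Box

variable {G X : Type*} [AddCommGroup G] [AddAction G X] [MeasurableSpace X] {μ : Measure X}

theorem UnitBdd.comp_vadd (hμ : IsGSystem G μ) {f : X → ℂ} (hf : UnitBdd f) (g : G) :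
    UnitBdd fun x => f (g +ᵥ x) :=
  ⟨hf.measurable.comp (hμ.measurePreserving g).measurable, fun _ => hf.norm_le _⟩

theorem UnitBdd.gowersDelta (hμ : IsGSystem G μ) {f : X → ℂ} (hf : UnitBdd f) (g g' : G) :
    UnitBdd (gowersDelta g g' f) :=
  (hf.comp_vadd hμ (-g)).mul (hf.comp_vadd hμ (-g')).conj

theorem IsGSystem.integral_comp_vadd (hμ : IsGSystem G μ) {f : X → ℂ} (hf : Measurable f) (g : G) :
    ∫ x, f (g +ᵥ x) ∂μ = ∫ x, f x ∂μ := by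
  have h := hμ.measurePreserving g
  conv_rhs => rw [← h.map_eq]
  rw [integral_map h.measurable.aemeasurable hf.aestronglyMeasurable]

/-- The box Cauchy–Schwarz inequality. -/
theorem norm_piAvg_pow_le_boxAvg (hμ : IsGSystem G μ) {n : ℕ} {A : Fin n → Multiset G}
    (hA : ∀ k, A k ≠ 0) {f : X → ℂ} (hf : UnitBdd f) {B : Fin n → (Fin n → G) → X → ℂ}
    (hB : ∀ k e, UnitBdd (B k e)) (hind : ∀ k e g, B k (Function.update e k g) = B k e) :
    ‖piAvg A fun e => ∫ x, f (-(∑ k, e k) +ᵥ x) * ∏ k, B k e x ∂μ‖ ^ 2 ^ n ≤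
      ‖boxAvg μ (List.ofFn A) f‖ := by
  have := hμ.isProbabilityMeasure
  induction n generalizing f with
  | zero => simp [piAvg_zero, boxAvg]
  | succ n ih =>
    have hne := fun k => Multiset.nonempty_fin_of_ne_zero (hA k)
    -- `B 0` ignores the first coordinate, so it is a weight in the remaining ones. Cauchy–Schwarz
    -- removes it and doubles the first coordinate into `a, a'`; this turns `f` into `gowersDelta a
    -- a' f` and leaves `n` factors for the induction.
    have h0 : ∀ (e : Fin n → G) (a : G), B 0 (Fin.cons a e) = B 0 (Fin.cons 0 e) := fun e a => by
      rw [← hind 0 (Fin.cons 0 e) a, Fin.update_cons_zero]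
    let Z : G → (Fin n → G) → X → ℂ := fun a e x =>
      shift a f (-(∑ k, e k) +ᵥ x) * ∏ k, B (Fin.succ k) (Fin.cons a e) x
    have hZ : ∀ a e, UnitBdd (Z a e) := fun a e =>
      ((hf.comp_vadd hμ (-a)).comp_vadd hμ (-∑ k, e k)).mul (UnitBdd.prod _ fun k _ => hB _ _)
    have e1 : (piAvg A fun e => ∫ x, f (-(∑ k, e k) +ᵥ x) * ∏ k, B k e x ∂μ) =
        multisetAvg (A 0) fun a => piAvg (fun k => A k.succ) fun e =>
          ∫ x, B 0 (Fin.cons 0 e) x * Z a e x ∂μ := by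
      rw [piAvg_succ]
      congr! 5 with a e
      funext x
      rw [Fin.sum_univ_succ, Fin.prod_univ_succ, h0]
      simp only [Fin.cons_zero, Fin.cons_succ, Z, shift, vadd_vadd, neg_add]
      ring
    have e2 := norm_expect_integral_sq_le (μ := μ)
      (b := fun t : (∀ k : Fin n, Fin (A k.succ).toList.length) =>
        B 0 (Fin.cons 0 fun k => (A k.succ).enum (t k)))
      (Z := fun s t => Z ((A 0).enum s) fun k => (A k.succ).enum (t k))
      (fun t => hB _ _) (fun s t => hZ _ _)
    have e3 : ∀ a a', (piAvg (fun k => A k.succ) fun e =>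
        ∫ x, Z a e x * (starRingEnd ℂ) (Z a' e x) ∂μ) =
        piAvg (fun k => A k.succ) fun e => ∫ x, gowersDelta a a' f (-(∑ k, e k) +ᵥ x) *
          ∏ k, (B (Fin.succ k) (Fin.cons a e) x *
            (starRingEnd ℂ) (B (Fin.succ k) (Fin.cons a' e) x)) ∂μ := by
      intro a a'
      congr! 4 with e
      simp only [Z, gowersDelta, map_mul, map_prod, Finset.prod_mul_distrib]
      ring
    let J : G → G → ℂ := fun a a' => piAvg (fun k => A k.succ) fun e =>
      ∫ x, Z a e x * (starRingEnd ℂ) (Z a' e x) ∂μ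
    have e4 : ‖piAvg A fun e => ∫ x, f (-(∑ k, e k) +ᵥ x) * ∏ k, B k e x ∂μ‖ ^ 2 ≤
        ‖multisetAvg (A 0) fun a => multisetAvg (A 0) fun a' => J a a'‖ := by
      rw [e1]
      simpa only [multisetAvg_eq_expect, piAvg_eq, J] using e2
    have ih' : ∀ a a', ‖J a a'‖ ^ 2 ^ n ≤
        ‖boxAvg μ (List.ofFn fun k => A k.succ) (gowersDelta a a' f)‖ := by
      intro a a'
      simp only [J, e3]
      refine ih (fun k => hA k.succ) (hf.gowersDelta hμ a a')
        (B := fun k e x => B (Fin.succ k) (Fin.cons a e) x *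
            (starRingEnd ℂ) (B (Fin.succ k) (Fin.cons a' e) x))
        (fun k e => (hB _ _).mul (hB _ _).conj) fun k e g => ?_
      simp only [Fin.cons_update, hind]
    rw [List.ofFn_succ]
    -- For `n = 0` the estimate `e4` is already the claim. Otherwise the inner box averages are
    -- non-negative reals, so that the norm can be taken out of the average over `a, a'` again; over
    -- the empty list this would fail.
    rcases n with _ | n
    · simp only [boxAvg, List.ofFn_zero]
      refine (by simpa using e4 : _ ≤ _).trans (le_of_eq ?_)
      congr! 5 with a a'
      simp [J, piAvg_zero, Z, gowersDelta]
    · have hnn : ∀ a a' : G, boxAvg μ (List.ofFn fun k => A (Fin.succ k)) (gowersDelta a a' f) =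
          ((‖boxAvg μ (List.ofFn fun k => A (Fin.succ k)) (gowersDelta a a' f)‖ : ℝ) : ℂ) := by
        intro a a'
        rw [List.ofFn_succ]
        obtain ⟨r, hr, h⟩ := hμ.boxAvg_nonneg (A (Fin.succ 0))
          (List.ofFn fun k => A (Fin.succ (Fin.succ k))) ((hf.gowersDelta hμ a a').memLp μ)
        rw [h, Complex.norm_real, Real.norm_of_nonneg hr]
      rw [pow_succ', pow_mul]
      calc _ ≤ ‖multisetAvg (A 0) fun a => multisetAvg (A 0) fun a' => J a a'‖ ^ 2 ^ (n + 1) :=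
            pow_le_pow_left₀ (by positivity) e4 _
        _ ≤ (𝔼 s, 𝔼 s', ‖J ((A 0).enum s) ((A 0).enum s')‖) ^ 2 ^ (n + 1) := by
            refine pow_le_pow_left₀ (norm_nonneg _) ?_ _
            simp only [multisetAvg_eq_expect]
            refine (norm_expect_le _ _).trans (Finset.expect_le_expect fun s _ => ?_)
            exact norm_expect_le _ _
        _ ≤ 𝔼 s, 𝔼 s', ‖J ((A 0).enum s) ((A 0).enum s')‖ ^ 2 ^ (n + 1) := by
            refine (expect_pow_le_expect_pow _ (fun s => Finset.expect_nonneg fun _ _ =>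
              norm_nonneg _) _).trans (Finset.expect_le_expect fun s _ => ?_)
            exact expect_pow_le_expect_pow _ (fun _ => norm_nonneg _) _
        _ ≤ 𝔼 s, 𝔼 s', ‖boxAvg μ (List.ofFn fun k => A (Fin.succ k))
              (gowersDelta ((A 0).enum s) ((A 0).enum s') f)‖ :=
            Finset.expect_le_expect fun s _ => Finset.expect_le_expect fun s' _ => ih' _ _
        _ = _ := by
            simp only [boxAvg, multisetAvg_eq_expect]
            have : (𝔼 s, 𝔼 s', boxAvg μ (List.ofFn fun k => A (Fin.succ k))
                (gowersDelta ((A 0).enum s) ((A 0).enum s') f)) =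
                ((𝔼 s, 𝔼 s', ‖boxAvg μ (List.ofFn fun k => A (Fin.succ k))
                (gowersDelta ((A 0).enum s) ((A 0).enum s') f)‖ : ℝ) : ℂ) := by
              rw [ofReal_expect]
              refine Finset.expect_congr rfl fun s _ => ?_
              rw [ofReal_expect]
              exact Finset.expect_congr rfl fun s' _ => hnn _ _
            rw [this, Complex.norm_real, Real.norm_of_nonneg]
            exact Finset.expect_nonneg fun _ _ => Finset.expect_nonneg fun _ _ => norm_nonneg _

/-- Complex conjugation iterated as often as `ω` takes the value `true`. -/
def conjPow : ∀ {n : ℕ}, (Fin n → Bool) → ℂ →+* ℂ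
  | 0, _ => RingHom.id ℂ
  | _ + 1, ω => (conjPow fun k => ω k.succ).comp (if ω 0 then starRingEnd ℂ else RingHom.id ℂ)

theorem conjPow_cases {n : ℕ} (ω : Fin n → Bool) :
    conjPow ω = RingHom.id ℂ ∨ conjPow ω = starRingEnd ℂ := by
  induction n with
  | zero => exact Or.inl rfl
  | succ n ih =>
    rw [conjPow]
    rcases ih fun k => ω k.succ with h | h <;> rw [h] <;> split_ifs <;> simp

theorem conjPow_false {n : ℕ} : conjPow (fun _ : Fin n => false) = RingHom.id ℂ := by
  induction n with
  | zero => rfl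
  | succ n ih => simp [conjPow, ih]

theorem UnitBdd.conjPow {n : ℕ} (ω : Fin n → Bool) {f : X → ℂ} (hf : UnitBdd f) :
    UnitBdd fun x => conjPow ω (f x) := by
  rcases conjPow_cases ω with h | h <;> simp only [h]
  · exact hf
  · exact hf.conj

theorem boxAvg_eq_piAvg {n : ℕ} (A : Fin n → Multiset G) (f : X → ℂ) :
    boxAvg μ (List.ofFn A) f = piAvg A fun h => piAvg A fun h' =>
      ∫ x, ∏ ω : Fin n → Bool,
        conjPow ω (f (-(∑ k, if ω k then h' k else h k) +ᵥ x)) ∂μ := by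
  induction n generalizing f with
  | zero => simp [boxAvg, piAvg_zero, conjPow]
  | succ n ih =>
    rw [List.ofFn_succ, boxAvg, piAvg_succ]
    congr 1
    funext a
    have hsw : ∀ Ψ : G → (Fin n → G) → ℂ, (multisetAvg (A 0) fun a' =>
        piAvg (fun k => A k.succ) fun h => Ψ a' h) =
        piAvg (fun k => A k.succ) fun h => multisetAvg (A 0) fun a' => Ψ a' h := by
      intro Ψ
      simp only [multisetAvg_eq_expect, piAvg_eq]
      exact Finset.expect_comm _ _ _
    simp_rw [ih]
    rw [hsw]
    congr 1
    funext h
    rw [piAvg_succ]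
    congr! 5 with a' h'
    funext x
    rw [← (Fin.consEquiv fun _ : Fin (n + 1) => Bool).prod_comp, Fintype.prod_prod_type,
      Fintype.prod_bool, ← Finset.prod_mul_distrib]
    refine Finset.prod_congr rfl fun ω _ => ?_
    simp only [Fin.consEquiv, Equiv.coe_fn_mk, conjPow, gowersDelta, shift, Fin.sum_univ_succ,
      vadd_vadd, Fin.cons_zero, Fin.cons_succ, RingHom.comp_apply, map_mul, if_true, neg_add,
      Bool.false_eq_true, if_false, RingHom.id_apply]
    exact mul_comm _ _

/-- The dual function of `f` for the box norm along `A`. -/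
def boxDual {n : ℕ} (A : Fin n → Multiset G) (f : X → ℂ) (x : X) : ℂ :=
  piAvg A fun h => piAvg A fun h' => ∏ ω ∈ Finset.univ.erase fun _ : Fin n => false,
    conjPow ω (f ((∑ k, if ω k then h k - h' k else 0) +ᵥ x))

theorem UnitBdd.boxDual (hμ : IsGSystem G μ) {n : ℕ} (A : Fin n → Multiset G) {f : X → ℂ}
    (hf : UnitBdd f) : UnitBdd (boxDual A f) :=
  UnitBdd.piAvg A fun _ => UnitBdd.piAvg A fun _ => UnitBdd.prod _ fun ω _ =>
    (hf.comp_vadd hμ _).conjPow ω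

/-- Translating the integral by `∑ k, h k` turns the factor at the vertex `ω = false` into `f`
itself; the other vertices make up the dual function. -/
theorem boxAvg_eq_integral_mul_boxDual (hμ : IsGSystem G μ) {n : ℕ} (A : Fin n → Multiset G)
    {f : X → ℂ} (hf : UnitBdd f) :
    boxAvg μ (List.ofFn A) f = ∫ x, f x * boxDual A f x ∂μ := by
  have := hμ.isProbabilityMeasure
  have hP : ∀ h h' : Fin n → G, UnitBdd fun x => f x *
      ∏ ω ∈ Finset.univ.erase fun _ : Fin n => false,
        conjPow ω (f ((∑ k, if ω k then h k - h' k else 0) +ᵥ x)) := fun h h' =>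
    hf.mul (UnitBdd.prod _ fun ω _ => (hf.comp_vadd hμ _).conjPow ω)
  have e1 : ∀ h h' : Fin n → G, ∫ x, ∏ ω : Fin n → Bool,
      conjPow ω (f (-(∑ k, if ω k then h' k else h k) +ᵥ x)) ∂μ =
      ∫ x, f x * ∏ ω ∈ Finset.univ.erase fun _ : Fin n => false,
        conjPow ω (f ((∑ k, if ω k then h k - h' k else 0) +ᵥ x)) ∂μ := by
    intro h h'
    rw [← hμ.integral_comp_vadd (UnitBdd.measurable (UnitBdd.prod _ fun ω _ =>
      (hf.comp_vadd hμ _).conjPow ω)) (∑ k, h k)]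
    congr 1
    funext x
    rw [← Finset.mul_prod_erase _ _ (Finset.mem_univ fun _ => false)]
    congr 1
    · simp [conjPow_false, vadd_vadd]
    · refine Finset.prod_congr rfl fun ω _ => ?_
      rw [vadd_vadd, ← Finset.sum_neg_distrib, ← Finset.sum_add_distrib]
      congr! 4 with k
      split_ifs <;> abel
  rw [boxAvg_eq_piAvg]
  simp_rw [e1, boxDual, piAvg_eq, Finset.mul_expect]
  rw [integral_expect fun t => (UnitBdd.expect fun t' => hP _ _).integrable μ]
  refine Finset.expect_congr rfl fun t _ => ?_
  rw [integral_expect fun t' => (hP _ _).integrable μ]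

end Box

/-! ### Approximation by products of functions ignoring a coordinate -/

section BoxRep

variable {G X κ : Type*} [MeasurableSpace X] [Fintype κ] [DecidableEq κ]

/-- For `e ∈ D`, the function `Θ e` is within `M * τ` of a linear combination, with coefficients of
total size at most `M`, of products over `k` of functions bounded by `1` which do not depend on
`e k`. -/
def BoxRep (D : Set (κ → G)) (τ M : ℝ) (Θ : (κ → G) → X → ℂ) : Prop :=
  ∃ (n : ℕ) (c : Fin n → ℂ) (B : Fin n → κ → (κ → G) → X → ℂ), ∑ s, ‖c s‖ ≤ M ∧
    (∀ s k e, UnitBdd (B s k e)) ∧ (∀ s k e g, B s k (Function.update e k g) = B s k e) ∧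
    ∀ e ∈ D, ∀ x, ‖Θ e x - ∑ s, c s * ∏ k, B s k e x‖ ≤ M * τ

variable {D : Set (κ → G)} {τ M M' : ℝ} {Θ Θ' : (κ → G) → X → ℂ}

namespace BoxRep

theorem of_fintype {S : Type*} [Fintype S] (c : S → ℂ) (B : S → κ → (κ → G) → X → ℂ)
    (hc : ∑ s, ‖c s‖ ≤ M) (hB : ∀ s k e, UnitBdd (B s k e))
    (hind : ∀ s k e g, B s k (Function.update e k g) = B s k e)
    (h : ∀ e ∈ D, ∀ x, ‖Θ e x - ∑ s, c s * ∏ k, B s k e x‖ ≤ M * τ) : BoxRep D τ M Θ := by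
  let σ := (Fintype.equivFin S).symm
  refine ⟨_, fun s => c (σ s), fun s => B (σ s), ?_, fun s => hB _, fun s => hind _,
    fun e he x => ?_⟩
  · rwa [σ.sum_comp fun s => ‖c s‖]
  · rw [σ.sum_comp fun s => c s * ∏ k, B s k e x]
    exact h e he x

theorem nonneg (h : BoxRep D τ M Θ) : 0 ≤ M := by
  obtain ⟨n, c, B, hc, -⟩ := h
  exact (Finset.sum_nonneg fun _ _ => norm_nonneg _).trans hc

theorem approx (h : BoxRep D τ M Θ) {δ : ℝ} (hM : M ≤ M') (hδ : M * τ + δ ≤ M' * τ)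
    (hΘ : ∀ e ∈ D, ∀ x, ‖Θ' e x - Θ e x‖ ≤ δ) : BoxRep D τ M' Θ' := by
  obtain ⟨n, c, B, hc, hB, hi, hr⟩ := h
  refine ⟨n, c, B, hc.trans hM, hB, hi, fun e he x => ?_⟩
  have := norm_sub_le_norm_sub_add_norm_sub (Θ' e x) (Θ e x) (∑ s, c s * ∏ k, B s k e x)
  linarith [hr e he x, hΘ e he x]

theorem mono (h : BoxRep D τ M Θ) (hτ : 0 ≤ τ) (hM : M ≤ M') : BoxRep D τ M' Θ :=
  h.approx (δ := 0) hM (by simpa using mul_le_mul_of_nonneg_right hM hτ) fun e _ x => by simp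

theorem congr (h : BoxRep D τ M Θ) (hΘ : ∀ e ∈ D, ∀ x, Θ' e x = Θ e x) : BoxRep D τ M Θ' :=
  h.approx (δ := 0) le_rfl (by simp) fun e he x => by simp [hΘ e he x]

theorem mono_set (h : BoxRep D τ M Θ) {D' : Set (κ → G)} (hD : D' ⊆ D) : BoxRep D' τ M Θ := by
  obtain ⟨n, c, B, hc, hB, hi, hr⟩ := h
  exact ⟨n, c, B, hc, hB, hi, fun e he => hr e (hD he)⟩

theorem sum {T : Type*} [Fintype T] {a : T → ℂ} {M : T → ℝ} {Θ : T → (κ → G) → X → ℂ}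
    (h : ∀ t, BoxRep D τ (M t) (Θ t)) :
    BoxRep D τ (∑ t, ‖a t‖ * M t) fun e x => ∑ t, a t * Θ t e x := by
  choose n c B hc hB hi hr using h
  refine of_fintype (S := Σ t, Fin (n t)) (fun s => a s.1 * c s.1 s.2) (fun s => B s.1 s.2) ?_
    (fun s => hB _ _) (fun s => hi _ _) fun e he x => ?_
  · rw [Fintype.sum_sigma]
    refine Finset.sum_le_sum fun t _ => ?_
    simp only [norm_mul, ← Finset.mul_sum]
    exact mul_le_mul_of_nonneg_left (hc t) (norm_nonneg _)
  · rw [Fintype.sum_sigma, ← Finset.sum_sub_distrib, Finset.sum_mul]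
    refine (norm_sum_le _ _).trans (Finset.sum_le_sum fun t _ => ?_)
    simp only [mul_assoc, ← Finset.mul_sum, ← mul_sub, norm_mul]
    exact mul_le_mul_of_nonneg_left (hr t e he x) (norm_nonneg _)

theorem expect {T : Type*} [Fintype T] [Nonempty T] {Θ : T → (κ → G) → X → ℂ}
    (h : ∀ t, BoxRep D τ M (Θ t)) : BoxRep D τ M fun e x => 𝔼 t, Θ t e x := by
  have := sum (a := fun _ : T => ((Fintype.card T : ℂ))⁻¹) h
  have hT : (Fintype.card T : ℝ) ≠ 0 := by exact_mod_cast Fintype.card_ne_zero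
  simp only [norm_inv, Complex.norm_natCast, Finset.sum_const, Finset.card_univ, nsmul_eq_mul,
    mul_inv_cancel_left₀ hT] at this
  refine this.congr fun e _ x => ?_
  rw [Fintype.expect_eq_sum_div_card, div_eq_inv_mul, Finset.mul_sum]

theorem piAvg {n : ℕ} {A : Fin n → Multiset G} (hA : ∀ k, A k ≠ 0)
    {Θ : (Fin n → G) → (κ → G) → X → ℂ} (h : ∀ t, BoxRep D τ M (Θ t)) :
    BoxRep D τ M fun e x => _root_.piAvg A fun t => Θ t e x := by
  have := fun k => Multiset.nonempty_fin_of_ne_zero (hA k)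
  exact expect fun t => h _

theorem smul (h : BoxRep D τ M Θ) (a : ℂ) : BoxRep D τ (‖a‖ * M) fun e x => a * Θ e x := by
  simpa using sum (T := Unit) (a := fun _ => a) fun _ => h

theorem add (h : BoxRep D τ M Θ) (h' : BoxRep D τ M' Θ') :
    BoxRep D τ (M + M') fun e x => Θ e x + Θ' e x := by
  have := sum (T := Bool) (a := fun _ => 1) (M := fun b => cond b M M')
    (Θ := fun b => cond b Θ Θ') (D := D) (τ := τ) (by rintro (_ | _) <;> assumption)
  simpa using this

theorem conj (h : BoxRep D τ M Θ) : BoxRep D τ M fun e x => (starRingEnd ℂ) (Θ e x) := by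
  obtain ⟨n, c, B, hc, hB, hi, hr⟩ := h
  refine ⟨n, fun s => (starRingEnd ℂ) (c s), fun s k e x => (starRingEnd ℂ) (B s k e x),
    by simpa using hc, fun s k e => (hB s k e).conj, fun s k e g => by simp [hi],
    fun e he x => ?_⟩
  have := hr e he x
  rw [← RCLike.norm_conj] at this
  simpa [map_sub, map_sum, map_prod] using this

theorem conjPow {n : ℕ} (ω : Fin n → Bool) (h : BoxRep D τ M Θ) :
    BoxRep D τ M fun e x => conjPow ω (Θ e x) := by
  rcases conjPow_cases ω with h' | h' <;> simp only [h']
  · exact h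
  · exact h.conj

theorem of_indep (k : κ) (hΘ : ∀ e, UnitBdd (Θ e))
    (hi : ∀ e g, Θ (Function.update e k g) = Θ e) (hτ : 0 ≤ τ) : BoxRep D τ 1 Θ := by
  refine of_fintype (S := Unit) (fun _ => 1) (fun _ l e x => if l = k then Θ e x else 1)
    (by simp) (fun _ l e => ?_) (fun _ l e g => ?_) fun e _ x => by simpa using hτ
  · split_ifs
    exacts [hΘ e, UnitBdd.one]
  · split_ifs with h
    · subst h
      simp [hi]
    · rfl

theorem one (hτ : 0 ≤ τ) : BoxRep D τ 1 fun (_ : κ → G) (_ : X) => (1 : ℂ) :=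
  of_fintype (S := Unit) (fun _ => 1) (fun _ _ _ _ => 1) (by simp) (fun _ _ _ => UnitBdd.one)
    (fun _ _ _ _ => rfl) fun e _ x => by simpa using hτ

/-- The product of the two approximations leaves three error terms, each at most `M * M' * τ`
because `τ ≤ 1`; this is the factor `3`. Measuring the error in units of the complexity is what lets
sums and products be tracked by the single number `M`. -/
theorem mul (h : BoxRep D τ M Θ) (h' : BoxRep D τ M' Θ') (hτ : 0 ≤ τ) (hτ1 : τ ≤ 1) :
    BoxRep D τ (3 * (M * M')) fun e x => Θ e x * Θ' e x := by
  have hM := h.nonneg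
  have hM' := h'.nonneg
  obtain ⟨n, c, B, hc, hB, hi, hr⟩ := h
  obtain ⟨n', c', B', hc', hB', hi', hr'⟩ := h'
  have hP : ∀ e x, ‖∑ s, c s * ∏ k, B s k e x‖ ≤ M := fun e x =>
    (norm_sum_le _ _).trans <| le_trans (Finset.sum_le_sum fun s _ => by
      rw [norm_mul]
      exact mul_le_of_le_one_right (norm_nonneg _)
        ((UnitBdd.prod Finset.univ fun k _ => hB s k e).norm_le x)) hc
  refine of_fintype (S := Fin n × Fin n') (fun s => c s.1 * c' s.2)
    (fun s k e x => B s.1 k e x * B' s.2 k e x) ?_ (fun s k e => (hB _ _ _).mul (hB' _ _ _))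
    (fun s k e g => by simp [hi, hi']) fun e he x => ?_
  · simp only [norm_mul, Fintype.sum_prod_type, ← Finset.mul_sum, ← Finset.sum_mul]
    have := mul_le_mul hc hc' (Finset.sum_nonneg fun _ _ => norm_nonneg _) hM
    nlinarith [mul_nonneg hM hM']
  · have e1 : ∑ s : Fin n × Fin n', c s.1 * c' s.2 * ∏ k, B s.1 k e x * B' s.2 k e x =
        (∑ s, c s * ∏ k, B s k e x) * ∑ s, c' s * ∏ k, B' s k e x := by
      rw [Fintype.sum_prod_type, Finset.sum_mul_sum]
      refine Finset.sum_congr rfl fun s _ => Finset.sum_congr rfl fun s' _ => ?_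
      rw [Finset.prod_mul_distrib]
      ring
    rw [e1]
    have h1 := hr e he x
    have h2 := hr' e he x
    have h3 := hP e x
    set P := ∑ s, c s * ∏ k, B s k e x
    set P' := ∑ s, c' s * ∏ k, B' s k e x
    have e2 : Θ e x * Θ' e x - P * P' =
        (Θ e x - P) * (Θ' e x - P') + (Θ e x - P) * P' + P * (Θ' e x - P') := by ring
    have h4 : ‖P'‖ ≤ M' := (norm_sum_le _ _).trans <| le_trans (Finset.sum_le_sum fun s _ => by
      rw [norm_mul]
      exact mul_le_of_le_one_right (norm_nonneg _)
        ((UnitBdd.prod Finset.univ fun k _ => hB' s k e).norm_le x)) hc'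
    rw [e2]
    refine (norm_add₃_le).trans ?_
    simp only [norm_mul]
    have i1 : ‖Θ e x - P‖ * ‖Θ' e x - P'‖ ≤ M * τ * (M' * τ) :=
      mul_le_mul h1 h2 (norm_nonneg _) (by positivity)
    have i2 : ‖Θ e x - P‖ * ‖P'‖ ≤ M * τ * M' :=
      mul_le_mul h1 h4 (norm_nonneg _) (by positivity)
    have i3 : ‖P‖ * ‖Θ' e x - P'‖ ≤ M * (M' * τ) :=
      mul_le_mul h3 h2 (norm_nonneg _) hM
    have i4 : M * τ * (M' * τ) ≤ M * τ * M' :=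
      mul_le_mul_of_nonneg_left (mul_le_of_le_one_right hM' hτ1) (by positivity)
    linarith

theorem prod {T : Type*} (s : Finset T) {Θ : T → (κ → G) → X → ℂ} (hτ : 0 ≤ τ) (hτ1 : τ ≤ 1)
    (h : ∀ t ∈ s, BoxRep D τ M (Θ t)) : BoxRep D τ ((3 * M) ^ s.card) fun e x => ∏ t ∈ s, Θ t e x := by
  classical
  induction s using Finset.induction_on with
  | empty => simpa using one hτ
  | insert t s ht ih =>
    have := (h t (Finset.mem_insert_self _ _)).mul
      (ih fun u hu => h u (Finset.mem_insert_of_mem hu)) hτ hτ1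
    simp only [Finset.prod_insert ht, Finset.card_insert_of_notMem ht, pow_succ']
    rwa [mul_assoc]

theorem reindex {κ' : Type*} [Fintype κ'] [DecidableEq κ'] (σ : κ ≃ κ') (h : BoxRep D τ M Θ) :
    BoxRep {e : κ' → G | e ∘ σ ∈ D} τ M fun e => Θ (e ∘ σ) := by
  obtain ⟨n, c, B, hc, hB, hi, hr⟩ := h
  refine ⟨n, c, fun s k e => B s (σ.symm k) (e ∘ σ), hc, fun s k e => hB _ _ _,
    fun s k e g => ?_, fun e he x => ?_⟩
  · change B s (σ.symm k) (Function.update e k g ∘ σ) = B s (σ.symm k) (e ∘ σ)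
    rw [← hi s (σ.symm k) (e ∘ σ) g]
    congr 1
    funext l
    simp [Function.update_apply, Equiv.eq_symm_apply]
  · have : ∀ s, ∏ k, B s (σ.symm k) (e ∘ σ) x = ∏ k, B s k (e ∘ σ) x := fun s =>
      σ.symm.prod_comp fun k => B s k (e ∘ σ) x
    simpa only [this] using hr _ he x

end BoxRep

end BoxRep

/-! ### Structured functions -/

section Str

variable {G X κ : Type*} [AddCommGroup G] [AddAction G X] [MeasurableSpace X] [Fintype κ]
  [DecidableEq κ]

/-- Functions that are structured along `A`: up to a small error, the translate of `F` by
`-∑ k, e k` is a combination of products of functions not depending on one of the `e k ∈ A k`. -/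
structure IsStr (A : κ → Set G) (τ M : ℝ) (F : X → ℂ) : Prop where
  measurable : Measurable F
  rep : BoxRep {e | ∀ k, e k ∈ A k} τ M fun e x => F (-(∑ k, e k) +ᵥ x)

variable {μ : Measure X} {A : κ → Set G} {τ M M' : ℝ} {F F' : X → ℂ}

namespace IsStr

theorem mono (h : IsStr A τ M F) {A' : κ → Set G} (hA : ∀ k, A' k ⊆ A k) (hτ : 0 ≤ τ)
    (hM : M ≤ M') : IsStr A' τ M' F :=
  ⟨h.1, (h.2.mono hτ hM).mono_set fun _ he k => hA k (he k)⟩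

theorem add (h : IsStr A τ M F) (h' : IsStr A τ M' F') : IsStr A τ (M + M') fun x => F x + F' x :=
  ⟨h.1.add h'.1, h.2.add h'.2⟩

theorem smul (h : IsStr A τ M F) (a : ℂ) : IsStr A τ (‖a‖ * M) fun x => a * F x :=
  ⟨h.1.const_mul a, h.2.smul a⟩

theorem mul (h : IsStr A τ M F) (h' : IsStr A τ M' F') (hτ : 0 ≤ τ) (hτ1 : τ ≤ 1) :
    IsStr A τ (3 * (M * M')) fun x => F x * F' x :=
  ⟨h.1.mul h'.1, h.2.mul h'.2 hτ hτ1⟩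

theorem conj (h : IsStr A τ M F) : IsStr A τ M fun x => (starRingEnd ℂ) (F x) :=
  ⟨Complex.continuous_conj.measurable.comp h.1, h.2.conj⟩

theorem expect {T : Type*} [Fintype T] [Nonempty T] {F : T → X → ℂ} (h : ∀ t, IsStr A τ M (F t)) :
    IsStr A τ M fun x => 𝔼 t, F t x :=
  ⟨by
    simp only [Fintype.expect_eq_sum_div_card]
    exact (Finset.measurable_fun_sum _ fun i _ => (h i).measurable).div_const _,
   BoxRep.expect fun t => (h t).2⟩

/-- The group is commutative, so a further translation can be moved into the factors `B` without
affecting which coordinates they ignore. -/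
theorem comp_vadd (hμ : IsGSystem G μ) (h : IsStr A τ M F) (g : G) :
    IsStr A τ M fun x => F (g +ᵥ x) := by
  refine ⟨h.1.comp (hμ.measurePreserving g).measurable, ?_⟩
  obtain ⟨n, c, B, hc, hB, hi, hr⟩ := h.2
  refine ⟨n, c, fun s k e x => B s k e (g +ᵥ x), hc, fun s k e => (hB s k e).comp_vadd hμ g,
    fun s k e g' => by simp [hi], fun e he x => ?_⟩
  have := hr e he (g +ᵥ x)
  simp only [vadd_vadd] at this ⊢
  rwa [add_comm] at this

theorem conjPow {n : ℕ} (ω : Fin n → Bool) (h : IsStr A τ M F) :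
    IsStr A τ M fun x => conjPow ω (F x) := by
  rcases conjPow_cases ω with h' | h' <;> simp only [h']
  · exact h
  · exact h.conj

theorem prod {T : Type*} (s : Finset T) {F : T → X → ℂ} (hτ : 0 ≤ τ) (hτ1 : τ ≤ 1)
    (h : ∀ t ∈ s, IsStr A τ M (F t)) : IsStr A τ ((3 * M) ^ s.card) fun x => ∏ t ∈ s, F t x :=
  ⟨Finset.measurable_fun_prod s fun t ht => (h t ht).1, BoxRep.prod s hτ hτ1 fun t ht => (h t ht).2⟩

theorem reindex {κ' : Type*} [Fintype κ'] [DecidableEq κ'] (σ : κ ≃ κ') (h : IsStr A τ M F) :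
    IsStr (fun k => A (σ.symm k)) τ M F := by
  refine ⟨h.1, ((h.2.reindex σ).mono_set fun e he k => ?_).congr fun e _ x => ?_⟩
  · simpa using he (σ k)
  · rw [← σ.sum_comp]
    rfl

theorem norm_le (h : IsStr A τ M F) (hA : ∀ k, (A k).Nonempty) (x : X) : ‖F x‖ ≤ M + M * τ := by
  choose e he using hA
  obtain ⟨n, c, B, hc, hB, hi, hr⟩ := h.2
  have h1 := hr e he ((∑ k, e k) +ᵥ x)
  simp only [neg_vadd_vadd] at h1
  have h2 : ‖∑ s, c s * ∏ k, B s k e ((∑ k, e k) +ᵥ x)‖ ≤ M :=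
    (norm_sum_le _ _).trans <| le_trans (Finset.sum_le_sum fun s _ => by
      rw [norm_mul]
      exact mul_le_of_le_one_right (norm_nonneg _)
        ((UnitBdd.prod Finset.univ fun k _ => hB s k e).norm_le _)) hc
  have := norm_le_norm_add_norm_sub' (F x) (∑ s, c s * ∏ k, B s k e ((∑ k, e k) +ᵥ x))
  linarith

end IsStr

/-- By invariance of `μ` the integral may be translated by `-∑ k, e k` and averaged over `e k ∈ A'
k`. Then `F` can be replaced by its combination of products at the cost `M * τ`, and box
Cauchy–Schwarz bounds the contribution of each product. -/
theorem IsStr.norm_integral_mul_le (hμ : IsGSystem G μ) {n : ℕ} {A : Fin n → Set G}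
    (hF : IsStr A τ M F) {f : X → ℂ} (hf : UnitBdd f) {A' : Fin n → Multiset G}
    (hA' : ∀ k, A' k ≠ 0) (hA : ∀ k, ∀ a ∈ A' k, a ∈ A k) (hτ : 0 ≤ τ) :
    ‖∫ x, f x * F x ∂μ‖ ≤ M * (boxNorm μ (List.ofFn A') f + τ) := by
  have := hμ.isProbabilityMeasure
  have hM := hF.2.nonneg
  have hFb := hF.norm_le fun k => (Multiset.exists_mem_of_ne_zero (hA' k)).imp fun a ha => hA k a ha
  obtain ⟨m, c, B, hc, hB, hi, hr⟩ := hF.2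
  have hFm := hF.1
  have hFi : ∀ g : G, Integrable (fun x => f (g +ᵥ x) * F (g +ᵥ x)) μ := fun g =>
    (memLp_top_of_bound (((hf.comp_vadd hμ g).measurable.mul
      (hFm.comp (hμ.measurePreserving g).measurable)).aestronglyMeasurable) (M + M * τ)
      (Eventually.of_forall fun x => (norm_mul _ _).le.trans
        ((mul_le_of_le_one_left (norm_nonneg _) (hf.norm_le _)).trans (hFb _)))).integrable le_top
  have hBi : ∀ (s : Fin m) (e : Fin n → G), UnitBdd fun x => f (-(∑ k, e k) +ᵥ x) * ∏ k, B s k e x := fun s e =>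
    (hf.comp_vadd hμ _).mul (UnitBdd.prod _ fun k _ => hB s k e)
  set β := boxNorm μ (List.ofFn A') f with hβ
  have hβ0 : 0 ≤ β := by
    rw [hβ, boxNorm]
    positivity
  have h1 : ∀ s, ‖piAvg A' fun e => ∫ x, f (-(∑ k, e k) +ᵥ x) * ∏ k, B s k e x ∂μ‖ ≤ β := by
    intro s
    have := norm_piAvg_pow_le_boxAvg hμ hA' hf (hB s) (hi s)
    rw [hβ, boxNorm, List.length_ofFn, one_div, Real.le_rpow_inv_iff_of_pos (norm_nonneg _)
      (norm_nonneg _) (by positivity)]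
    exact_mod_cast this
  have e1 : (piAvg A' fun e => ∫ x, f (-(∑ k, e k) +ᵥ x) * ∑ s, c s * ∏ k, B s k e x ∂μ) =
      ∑ s, c s * piAvg A' fun e => ∫ x, f (-(∑ k, e k) +ᵥ x) * ∏ k, B s k e x ∂μ := by
    simp only [piAvg_eq, Finset.mul_expect, ← Finset.expect_sum_comm]
    refine Finset.expect_congr rfl fun t _ => ?_
    simp only [← integral_const_mul]
    rw [← integral_finsetSum _ fun s _ => ((hBi s _).integrable μ).const_mul _]
    congr 1
    funext x
    rw [Finset.mul_sum]
    exact Finset.sum_congr rfl fun s _ => by ring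
  have e2 : (piAvg A' fun e => ∫ x, f (-(∑ k, e k) +ᵥ x) * F (-(∑ k, e k) +ᵥ x) ∂μ) =
      ∫ x, f x * F x ∂μ := by
    rw [← piAvg_const hA' (∫ x, f x * F x ∂μ)]
    congr 1
    funext e
    exact hμ.integral_comp_vadd (hf.measurable.mul hFm) _
  have h2 : ‖∑ s, c s * piAvg A' fun e => ∫ x, f (-(∑ k, e k) +ᵥ x) * ∏ k, B s k e x ∂μ‖ ≤
      M * β := by
    refine (norm_sum_le _ _).trans ((Finset.sum_le_sum fun s _ => ?_).trans
      ((Finset.sum_mul _ _ β).symm.le.trans (mul_le_mul_of_nonneg_right hc hβ0)))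
    rw [norm_mul]
    exact mul_le_mul_of_nonneg_left (h1 s) (norm_nonneg _)
  have h3 : ‖(piAvg A' fun e => ∫ x, f (-(∑ k, e k) +ᵥ x) * F (-(∑ k, e k) +ᵥ x) ∂μ) -
      piAvg A' fun e => ∫ x, f (-(∑ k, e k) +ᵥ x) * ∑ s, c s * ∏ k, B s k e x ∂μ‖ ≤ M * τ := by
    rw [← piAvg_sub]
    refine norm_piAvg_le _ _ (by positivity) fun e he => ?_
    rw [← integral_sub (hFi _)]
    · have := norm_integral_le_of_norm_le_const (μ := μ) (C := M * τ)
        (f := fun x => f (-(∑ k, e k) +ᵥ x) * F (-(∑ k, e k) +ᵥ x) -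
          f (-(∑ k, e k) +ᵥ x) * ∑ s, c s * ∏ k, B s k e x) (Eventually.of_forall fun x => by
          rw [← mul_sub, norm_mul]
          exact (mul_le_of_le_one_left (norm_nonneg _) (hf.norm_le _)).trans
            (hr e (fun k => hA k _ (he k)) x))
      simpa using this
    · simp only [Finset.mul_sum]
      refine integrable_finsetSum _ fun s _ => ?_
      simp only [mul_left_comm _ (c s)]
      exact ((hBi s e).integrable μ).const_mul _
  rw [e1, e2] at h3
  have := norm_le_norm_add_norm_sub' (∫ x, f x * F x ∂μ)
    (∑ s, c s * piAvg A' fun e => ∫ x, f (-(∑ k, e k) +ᵥ x) * ∏ k, B s k e x ∂μ)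
  linarith

end Str

/-! ### Structure of dual functions -/

section Dual

variable {G X κ : Type*} [AddCommGroup G] [AddAction G X] [MeasurableSpace X] [Fintype κ]
  [DecidableEq κ] {μ : Measure X} {R : κ → Set G} {τ M : ℝ} {F : X → ℂ}

theorem card_erase_false (n : ℕ) :
    (Finset.univ.erase fun _ : Fin n => false).card = 2 ^ n - 1 := by
  simp [Finset.card_erase_of_mem]

theorem IsStr.boxDual (hμ : IsGSystem G μ) (hF : IsStr R τ M F) (hτ : 0 ≤ τ) (hτ1 : τ ≤ 1) {n : ℕ}
    {A : Fin n → Multiset G} (hA : ∀ k, A k ≠ 0) :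
    IsStr R τ ((3 * M) ^ (2 ^ n - 1)) (boxDual A F) := by
  have := fun k => Multiset.nonempty_fin_of_ne_zero (hA k)
  rw [← card_erase_false n]
  exact IsStr.expect fun t => IsStr.expect fun t' => IsStr.prod _ hτ hτ1 fun ω _ =>
    (hF.comp_vadd hμ _).conjPow ω

/-- Only the block of coordinates `(k₀, l)` is used: the structure of `F` along `R` supplies the
factors at this block, the factors elsewhere are `1`, and the offset `y`, which ignores the block,
is absorbed into the factors. -/
theorem IsStr.boxRep_of_eq (hμ : IsGSystem G μ) (hF : IsStr R τ M F) {n : ℕ}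
    {C : Fin n × κ → Set G} {b : Fin n → κ → G → G}
    (hb : ∀ k l, ∀ g ∈ C (k, l), b k l g ∈ R l) (k₀ : Fin n) {y : (Fin n × κ → G) → G}
    (hy : ∀ e l g, y (Function.update e (k₀, l) g) = y e) :
    BoxRep {e | ∀ p, e p ∈ C p} τ M fun e x =>
      F (-(∑ l, b k₀ l (e (k₀, l))) +ᵥ (y e +ᵥ x)) := by
  obtain ⟨m, c, B, hc, hB, hi, hr⟩ := hF.2
  refine ⟨m, c, fun s p e x =>
      if p.1 = k₀ then B s p.2 (fun l => b k₀ l (e (k₀, l))) (y e +ᵥ x) else 1, hc,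
    fun s p e => ?_, fun s p e g => ?_, fun e he x => ?_⟩
  · by_cases hp : p.1 = k₀ <;> simp only [hp, if_true, if_false]
    exacts [(hB _ _ _).comp_vadd hμ _, UnitBdd.one]
  · obtain ⟨k, l⟩ := p
    rcases eq_or_ne k k₀ with rfl | hk
    · simp only [if_true, hy]
      have : (fun l' => b k l' (Function.update e (k, l) g (k, l'))) =
          Function.update (fun l' => b k l' (e (k, l'))) l (b k l g) := by
        funext l'
        rcases eq_or_ne l' l with rfl | hl <;> simp [*]
      rw [this, hi]
    · simp [hk]
  · have := hr (fun l => b k₀ l (e (k₀, l))) (fun l => hb _ _ _ (he (k₀, l))) (y e +ᵥ x)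
    simpa only [Fintype.prod_prod_type, Finset.prod_ite_irrel, Finset.prod_const_one,
      Finset.prod_ite_eq', Finset.mem_univ, if_true] using this

/-- The dual function of a function structured along `R` is structured along the sums of the
members of `R` with sets by whose elements the averages over `A` are almost invariant. -/
theorem IsStr.boxDual_add (hμ : IsGSystem G μ) (hF : IsStr R τ M F) (hF1 : UnitBdd F)
    (hτ : 0 ≤ τ) (hτ1 : τ ≤ 1) {n : ℕ} {A : Fin n → Multiset G} (hA : ∀ k, A k ≠ 0)
    {C : Fin n × κ → Set G} {δ K : ℝ} (hδ : 0 ≤ δ) (hK : n * (Fintype.card κ * δ) ≤ K * τ)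
    (hK0 : 0 ≤ K)
    (hC : ∀ k l, ∀ g ∈ C (k, l), ∃ a b, ShiftInv (A k) (-a) δ ∧ b ∈ R l ∧ g = a + b) :
    IsStr C τ ((3 * M) ^ (2 ^ n - 1) + K) (_root_.boxDual A F) := by
  refine ⟨(hF1.boxDual hμ A).measurable, ?_⟩
  choose! a b ha hb hab using hC
  let α : (Fin n × κ → G) → Fin n → G := fun e k => ∑ l, a k l (e (k, l))
  let β : (Fin n × κ → G) → Fin n → G := fun e k => ∑ l, b k l (e (k, l))
  -- This is the translation in the factor at `ω` once `h'` has been shifted by `-α`, which cancels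
  -- `α k` wherever `ω k` is true. Since `ω` is not identically false, it is true at some `k₀`, and
  -- then the coordinates `(k₀, l)` enter only through `β k₀`, a sum of elements of the `R l`: this
  -- is where the structure of `F` applies.
  let y : (Fin n → Bool) → (Fin n → G) → (Fin n → G) → (Fin n × κ → G) → G :=
    fun ω h h' e => (∑ k, if ω k then h k - h' k else -α e k) - ∑ k, β e k
  have hL : ∀ ω ∈ Finset.univ.erase fun _ : Fin n => false, ∀ h h',
      BoxRep {e | ∀ p, e p ∈ C p} τ M fun e x => _root_.conjPow ω (F (y ω h h' e +ᵥ x)) := by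
    intro ω hω h h'
    obtain ⟨k₀, hk₀⟩ : ∃ k, ω k = true := by
      by_contra! hne
      exact (Finset.mem_erase.1 hω).1 (funext fun k => by simpa using hne k)
    refine BoxRep.conjPow ω ((hF.boxRep_of_eq hμ hb k₀
      (y := fun e => (∑ k, if ω k then h k - h' k else -α e k) -
        ∑ k ∈ Finset.univ.erase k₀, β e k) fun e l g => ?_).congr fun e _ x => ?_)
    · congr 1
      · refine Finset.sum_congr rfl fun k _ => ?_
        rcases eq_or_ne k k₀ with rfl | hk
        · simp [hk₀]
        · simp [α, hk]
      · refine Finset.sum_congr rfl fun k hk => ?_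
        simp [β, (Finset.mem_erase.1 hk).1]
    · simp only [y, vadd_vadd, ← Finset.add_sum_erase _ _ (Finset.mem_univ k₀)]
      congr 2
      simp only [β]
      abel
  have hmain : BoxRep {e | ∀ p, e p ∈ C p} τ ((3 * M) ^ (2 ^ n - 1)) fun e x =>
      piAvg A fun h => piAvg A fun h' => ∏ ω ∈ Finset.univ.erase fun _ : Fin n => false,
        _root_.conjPow ω (F (y ω h h' e +ᵥ x)) := by
    rw [← card_erase_false n]
    exact BoxRep.piAvg hA fun h => BoxRep.piAvg hA fun h' =>
      BoxRep.prod _ hτ hτ1 fun ω hω => hL ω hω h h'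
  refine hmain.approx (δ := n * (Fintype.card κ * δ)) (by linarith) (by nlinarith)
    fun e he x => ?_
  have hsum : ∑ p, e p = ∑ k, α e k + ∑ k, β e k := by
    rw [Fintype.sum_prod_type, ← Finset.sum_add_distrib]
    refine Finset.sum_congr rfl fun k _ => ?_
    rw [← Finset.sum_add_distrib]
    exact Finset.sum_congr rfl fun l _ => hab _ _ _ (he _)
  rw [norm_sub_rev]
  simp only [_root_.boxDual]
  rw [← piAvg_sub]
  refine norm_piAvg_le _ _ (by positivity) fun h _ => ?_
  have hsh : ∀ k, ShiftInv (A k) ((fun k => -α e k) k) (Fintype.card κ * δ) := by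
    intro k
    have := ShiftInv.sum Finset.univ (A := A k) (e := fun l => -a k l (e (k, l)))
      fun l _ => ha k l _ (he (k, l))
    simpa [α] using this
  have key : ∀ h' : Fin n → G, (∏ ω ∈ Finset.univ.erase fun _ : Fin n => false,
      _root_.conjPow ω (F (y ω h h' e +ᵥ x))) =
      ∏ ω ∈ Finset.univ.erase fun _ : Fin n => false,
        _root_.conjPow ω (F ((∑ k, if ω k then h k - (h' + fun k => -α e k) k else 0) +ᵥ
          (-(∑ p, e p)) +ᵥ x)) := by
    intro h'
    refine Finset.prod_congr rfl fun ω _ => ?_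
    simp only [y, hsum, vadd_vadd, Pi.add_apply]
    congr 3
    rw [neg_add, ← add_assoc, sub_eq_add_neg, ← Finset.sum_neg_distrib (f := α e),
      ← Finset.sum_add_distrib]
    congr 2
    funext k
    split_ifs <;> abel
  -- What remains is the cost of the shift of `h'` by `-α`, where each `α k` is a sum of
  -- `Fintype.card κ` almost invariant translations.
  simp only [key]
  exact ShiftInv.piAvg (by positivity) hsh
    (Φ := fun h' => ∏ ω ∈ Finset.univ.erase fun _ : Fin n => false,
      _root_.conjPow ω (F ((∑ k, if ω k then h k - h' k else 0) +ᵥ (-(∑ p, e p)) +ᵥ x)))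
    fun h' => (UnitBdd.prod _ fun ω _ => (hF1.comp_vadd hμ _).conjPow ω).norm_le _

/-- Along `{0}` the translation is trivial, so every bounded function counts as structured. The
structure of the dual function of an arbitrary bounded function thereby becomes a case of
`IsStr.boxDual_add`. -/
theorem IsStr.of_unitBdd {f : X → ℂ} (hf : UnitBdd f) (hτ : 0 ≤ τ) :
    IsStr (fun _ : Unit => ({0} : Set G)) τ 1 f := by
  refine ⟨hf.measurable, (BoxRep.of_indep (Θ := fun _ => f) () (fun _ => hf) (fun _ _ => rfl)
    hτ).congr fun e he x => ?_⟩
  have : e () = 0 := he ()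
  simp [this]

theorem UnitBdd.isStr_boxDual (hμ : IsGSystem G μ) {f : X → ℂ} (hf : UnitBdd f) (hτ : 0 ≤ τ)
    (hτ1 : τ ≤ 1) {n : ℕ} {A : Fin n → Multiset G} (hA : ∀ k, A k ≠ 0) {E : Fin n → Set G}
    {δ K : ℝ} (hδ : 0 ≤ δ) (hK : n * δ ≤ K * τ) (hK0 : 0 ≤ K)
    (hE : ∀ k, ∀ g ∈ E k, ShiftInv (A k) (-g) δ) :
    IsStr E τ (3 ^ (2 ^ n - 1) + K) (_root_.boxDual A f) := by
  have := (IsStr.of_unitBdd hf hτ).boxDual_add hμ hf hτ hτ1 hA (C := fun p => E p.1) hδ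
    (by simpa using hK) hK0 fun k l g hg => ⟨g, 0, hE k g hg, rfl, by simp⟩
  simpa using this.reindex (Equiv.prodPUnit (Fin n))

end Dual

/-! ### Coset progressions -/

section CosetProgression

variable {G : Type*} [AddCommGroup G]

theorem multisetAvg_sumset (A B : Multiset G) (φ : G → ℂ) :
    multisetAvg (sumset A B) φ = multisetAvg A fun a => multisetAvg B fun b => φ (a + b) := by
  simp only [multisetAvg, sumset, Multiset.map_map, Function.comp_def, Multiset.card_map,
    Multiset.card_product, Multiset.sum_map_div]
  rw [div_div, mul_comm (B.card : ℂ), Nat.cast_mul]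
  congr 1
  induction A using Multiset.induction_on with
  | empty => simp
  | cons a s ih => simp [Multiset.cons_product, ih]

theorem multisetAvg_sumset' (A B : Multiset G) (φ : G → ℂ) :
    multisetAvg (sumset A B) φ = multisetAvg B fun b => multisetAvg A fun a => φ (a + b) := by
  rw [multisetAvg_sumset]
  simp only [multisetAvg_eq_expect]
  exact Finset.expect_comm _ _ _

theorem ShiftInv.sumset_left {A B : Multiset G} {e : G} {δ : ℝ} (hδ : 0 ≤ δ) (h : ShiftInv A e δ) :
    ShiftInv (sumset A B) e δ := by
  intro φ hφ
  rw [multisetAvg_sumset', multisetAvg_sumset', ← multisetAvg_sub]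
  refine norm_multisetAvg_le _ _ hδ fun b _ => ?_
  simpa only [add_right_comm] using h (fun a => φ (a + b)) fun _ => hφ _

theorem ShiftInv.sumset_right {A B : Multiset G} {e : G} {δ : ℝ} (hδ : 0 ≤ δ) (h : ShiftInv B e δ) :
    ShiftInv (sumset A B) e δ := by
  intro φ hφ
  rw [multisetAvg_sumset, multisetAvg_sumset, ← multisetAvg_sub]
  refine norm_multisetAvg_le _ _ hδ fun b _ => ?_
  simpa only [add_assoc] using h (fun a => φ (b + a)) fun _ => hφ _

theorem shiftInv_subgroup {H : AddSubgroup G} (hH : (H : Set G).Finite) (m : ℕ) {e : G}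
    (he : e ∈ H) : ShiftInv (m • hH.toFinset.val) e 0 := by
  intro φ _
  have key : (hH.toFinset.val.map fun a => φ (a + e)).sum = (hH.toFinset.val.map φ).sum := by
    refine Finset.sum_bij' (s := hH.toFinset) (t := hH.toFinset) (f := fun a => φ (a + e)) (g := φ)
      (fun a _ => a + e) (fun a _ => a - e) ?_ ?_ ?_ ?_ ?_
    · intro a ha
      simp only [Set.Finite.mem_toFinset, SetLike.mem_coe] at ha ⊢
      exact H.add_mem ha he
    · intro a ha
      simp only [Set.Finite.mem_toFinset, SetLike.mem_coe] at ha ⊢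
      exact H.sub_mem ha he
    all_goals simp
  simp [multisetAvg, Multiset.map_nsmul, Multiset.sum_nsmul, key]

theorem multisetAvg_finset {α : Type*} (s : Finset α) (F : α → ℂ) :
    multisetAvg s.val F = 𝔼 n ∈ s, F n := by
  rw [multisetAvg, Finset.expect_eq_sum_div_card]
  rfl

theorem piAvg_eq_multisetAvg_piFinset {α : Type*} {n : ℕ} (S : Fin n → Finset α)
    (Φ : (Fin n → α) → ℂ) :
    piAvg (fun k => (S k).val) Φ = multisetAvg (Fintype.piFinset S).val Φ := by
  rw [multisetAvg_finset, piAvg]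
  refine Finset.expect_nbij (fun t k => (S k).val.enum (t k)) (fun t _ => ?_) (fun _ _ => rfl)
    (fun t _ t' _ h => ?_) fun f hf => ?_
  · exact Fintype.mem_piFinset.2 fun k => (S k).val.enum_mem (t k)
  · funext k
    have hk := congrFun h k
    have hnd : (S k).val.toList.Nodup := by
      rw [← Multiset.coe_nodup, Multiset.coe_toList]
      exact (S k).nodup
    exact Fin.ext ((hnd.getElem_inj_iff).1 hk)
  · have hk : ∀ k, ∃ t, (S k).val.enum t = f k := by
      intro k
      have : f k ∈ (S k).val.toList := by
        rw [Multiset.mem_toList]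
        exact Fintype.mem_piFinset.1 hf k
      obtain ⟨i, hi, h⟩ := List.getElem_of_mem this
      exact ⟨⟨i, hi⟩, h⟩
    choose t ht using hk
    exact ⟨t, Finset.mem_coe.2 (Finset.mem_univ t), funext ht⟩

/-- The interval and its translate differ in at most `|m|` points on either side. -/
theorem shiftInv_Icc (L m : ℤ) (hL : 0 ≤ L) :
    ShiftInv (Finset.Icc (-L) L).val m (2 * |(m : ℝ)| / (2 * L + 1)) := by
  intro φ hφ
  have hcard : ((Finset.Icc (-L) L).card : ℝ) = 2 * L + 1 := by
    rw [Int.card_Icc]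
    have : ((L + 1 - -L).toNat : ℤ) = 2 * L + 1 := by omega
    exact_mod_cast this
  have hdiff : ∀ s t : Finset ℤ, ‖∑ n ∈ s, φ n - ∑ n ∈ t, φ n‖ ≤ (s \ t).card + (t \ s).card := by
    intro s t
    rw [← Finset.sum_sdiff_sub_sum_sdiff]
    refine (norm_sub_le _ _).trans (add_le_add ?_ ?_) <;>
    · refine (norm_sum_le _ _).trans ((Finset.sum_le_card_nsmul _ _ 1 fun n _ => hφ n).trans ?_)
      simp
  have hshift : ∑ n ∈ Finset.Icc (-L) L, φ (n + m) = ∑ n ∈ Finset.Icc (-L + m) (L + m), φ n := by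
    rw [← Finset.map_add_right_Icc, Finset.sum_map]
    rfl
  have hc1 : (Finset.Icc (-L + m) (L + m) \ Finset.Icc (-L) L).card ≤ m.natAbs := by
    refine (Finset.card_le_card (t := Finset.Ioc L (L + m) ∪ Finset.Ico (-L + m) (-L)) fun n => ?_)
      |>.trans ((Finset.card_union_le _ _).trans ?_)
    · simp only [Finset.mem_sdiff, Finset.mem_Icc, Finset.mem_union, Finset.mem_Ioc,
        Finset.mem_Ico]
      omega
    · simp only [Int.card_Ioc, Int.card_Ico]
      omega
  have hc2 : (Finset.Icc (-L) L \ Finset.Icc (-L + m) (L + m)).card ≤ m.natAbs := by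
    refine (Finset.card_le_card (t := Finset.Ioc (L + m) L ∪ Finset.Ico (-L) (-L + m)) fun n => ?_)
      |>.trans ((Finset.card_union_le _ _).trans ?_)
    · simp only [Finset.mem_sdiff, Finset.mem_Icc, Finset.mem_union, Finset.mem_Ioc,
        Finset.mem_Ico]
      omega
    · simp only [Int.card_Ioc, Int.card_Ico]
      omega
  have hm : (m.natAbs : ℝ) = |(m : ℝ)| := by
    rw [Nat.cast_natAbs, Int.cast_abs]
  have hL' : (0 : ℝ) ≤ L := by exact_mod_cast hL
  rw [multisetAvg_finset, multisetAvg_finset, Finset.expect_eq_sum_div_card,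
    Finset.expect_eq_sum_div_card, ← sub_div, norm_div, Complex.norm_natCast, hcard, hshift]
  gcongr
  refine (hdiff _ _).trans ?_
  rw [← hm]
  have h1 : ((Finset.Icc (-L + m) (L + m) \ Finset.Icc (-L) L).card : ℝ) ≤ m.natAbs := by
    exact_mod_cast hc1
  have h2 : ((Finset.Icc (-L) L \ Finset.Icc (-L + m) (L + m)).card : ℝ) ≤ m.natAbs := by
    exact_mod_cast hc2
  linarith

namespace CosetProgression

/-- The subgroup part is exactly invariant, and each of the `rank` intervals contributes at most `2
* τ`. -/
theorem shiftInv_dilate (Q : CosetProgression G) {s τ : ℝ} (hs : 0 < s) (hτ : 0 ≤ τ) {e : G}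
    (he : e ∈ Q.dilate (τ * s)) : ShiftInv (Q.dilate s) e (Q.rank * (2 * τ)) := by
  simp only [dilate, sumset, Multiset.mem_map, Multiset.mem_product, Prod.exists] at he
  obtain ⟨h, _, ⟨hh, n, hn, rfl⟩, rfl⟩ := he
  have hh' : h ∈ Q.H := by
    have := Multiset.mem_of_mem_nsmul hh
    simpa using this
  have hn' := (mem_intBox _ _).1 hn
  have h1 : ShiftInv (Q.dilate s) h 0 :=
    (shiftInv_subgroup Q.finite_H Q.mult hh').sumset_left le_rfl
  have h2 : ShiftInv ((intBox fun i => s * Q.N i).val.map fun n => ∑ i, n i • Q.v i)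
      (∑ i, n i • Q.v i) (Q.rank * (2 * τ)) := by
    intro φ hφ
    have hav : ∀ φ : G → ℂ, multisetAvg
        ((intBox fun i => s * Q.N i).val.map fun n => ∑ i, n i • Q.v i) φ =
        piAvg (fun i => (Finset.Icc (-⌊s * Q.N i⌋) ⌊s * Q.N i⌋).val)
          fun n => φ (∑ i, n i • Q.v i) := by
      intro φ
      rw [piAvg_eq_multisetAvg_piFinset]
      simp only [multisetAvg, Multiset.map_map, Multiset.card_map]
      rfl
    rw [hav, hav]
    have hadd : ∀ k : Fin Q.rank → ℤ, ∑ i, k i • Q.v i + ∑ i, n i • Q.v i =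
        ∑ i, (k + n) i • Q.v i := fun k => by
      simp [add_smul, Finset.sum_add_distrib]
    simp only [hadd]
    refine ShiftInv.piAvg (Φ := fun k => φ (∑ i, k i • Q.v i)) (by positivity) (fun i => ?_)
      fun k => hφ _
    have hN := mul_pos hs (Q.N_pos i)
    have hfl : 0 ≤ ⌊s * Q.N i⌋ := Int.floor_nonneg.2 hN.le
    have hfl' : (0 : ℝ) ≤ ⌊s * Q.N i⌋ := by exact_mod_cast hfl
    intro ψ hψ
    refine (shiftInv_Icc _ (n i) hfl ψ hψ).trans ?_
    rw [div_le_iff₀ (by positivity)]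
    have h3 := hn' i
    have h4 := Int.lt_floor_add_one (s * Q.N i)
    -- From `s * N < ⌊s * N⌋ + 1 ≤ 2 * ⌊s * N⌋ + 1`; this covers intervals consisting of `0` alone
    -- as well.
    have h5 : τ * (s * Q.N i) ≤ τ * (2 * ⌊s * Q.N i⌋ + 1) :=
      mul_le_mul_of_nonneg_left (by linarith) hτ
    have h6 : τ * s * Q.N i = τ * (s * Q.N i) := by ring
    linarith
  simpa using h1.add (h2.sumset_right (by positivity))

theorem mem_dilate_neg (Q : CosetProgression G) {s : ℝ} {e : G} (he : e ∈ Q.dilate s) :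
    -e ∈ Q.dilate s := by
  simp only [dilate, sumset, Multiset.mem_map, Multiset.mem_product, Prod.exists] at he ⊢
  obtain ⟨h, _, ⟨hh, n, hn, rfl⟩, rfl⟩ := he
  rw [Multiset.mem_nsmul] at hh
  refine ⟨-h, _, ⟨?_, -n, ?_, rfl⟩, ?_⟩
  · rw [Multiset.mem_nsmul]
    refine ⟨hh.1, ?_⟩
    simpa using hh.2
  · have := (mem_intBox _ _).1 hn
    exact (mem_intBox _ _).2 fun i => by simpa using this i
  · simp [add_comm]

theorem mem_dilate_mono (Q : CosetProgression G) {s s' : ℝ} (hs : s ≤ s') {e : G}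
    (he : e ∈ Q.dilate s) : e ∈ Q.dilate s' := by
  simp only [dilate, sumset, Multiset.mem_map, Multiset.mem_product, Prod.exists] at he ⊢
  obtain ⟨h, _, ⟨hh, n, hn, rfl⟩, rfl⟩ := he
  refine ⟨h, _, ⟨hh, n, ?_, rfl⟩, rfl⟩
  have := (mem_intBox _ _).1 hn
  exact (mem_intBox _ _).2 fun i =>
    (this i).trans (mul_le_mul_of_nonneg_right hs (Q.N_pos i).le)

theorem zero_mem_dilate (Q : CosetProgression G) {s : ℝ} (hs : 0 ≤ s) : 0 ∈ Q.dilate s := by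
  simp only [dilate, sumset, Multiset.mem_map, Multiset.mem_product, Prod.exists]
  refine ⟨0, 0, ⟨?_, 0, ?_, by simp⟩, by simp⟩
  · rw [Multiset.mem_nsmul]
    exact ⟨Q.mult_pos.ne', by simp⟩
  · exact (mem_intBox _ _).2 fun i => by
      simpa using mul_nonneg hs (Q.N_pos i).le

theorem dilate_ne_zero (Q : CosetProgression G) {s : ℝ} (hs : 0 ≤ s) : Q.dilate s ≠ 0 :=
  fun h => by simpa [h] using Q.zero_mem_dilate hs

theorem dilate_one (Q : CosetProgression G) : Q.dilate 1 = Q.toMultiset := by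
  simp [dilate, toMultiset]

end CosetProgression

end CosetProgression

/-! ### Polynomial truncation to a disc -/

section Truncation

theorem Complex.norm_sub_sq_eq (a b : ℂ) :
    ‖a - b‖ ^ 2 = ‖a‖ ^ 2 - 2 * (a * (starRingEnd ℂ) b).re + ‖b‖ ^ 2 := by
  simp only [← Complex.normSq_eq_norm_sq, Complex.normSq_sub]
  ring

/-- The radial projection to the closed unit disc, a convex set, does not move a point away from any
point of the disc. -/
theorem norm_sub_clamp_le {u z : ℂ} (hu : ‖u‖ ≤ 1) :
    ‖u - z * ((max 1 ‖z‖)⁻¹ : ℝ)‖ ≤ ‖u - z‖ := by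
  rcases le_total ‖z‖ 1 with hz | hz
  · simp [max_eq_left hz]
  · rw [max_eq_right hz]
    have hz0 : 0 < ‖z‖ := by linarith
    refine abs_le_of_sq_le_sq' ?_ (norm_nonneg _) |>.2
    have h2 : (u * (starRingEnd ℂ) z).re ≤ ‖z‖ := by
      refine (Complex.re_le_norm _).trans ?_
      rw [norm_mul, RCLike.norm_conj]
      exact mul_le_of_le_one_left hz0.le hu
    have h3 : (u * (starRingEnd ℂ) (z * ((‖z‖)⁻¹ : ℝ))).re =
        (u * (starRingEnd ℂ) z).re * ‖z‖⁻¹ := by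
      rw [map_mul, Complex.conj_ofReal, ← mul_assoc, Complex.re_mul_ofReal]
    have h4 : ‖z * ((‖z‖)⁻¹ : ℝ)‖ = 1 := by
      rw [norm_mul, Complex.norm_real, Real.norm_of_nonneg (by positivity)]
      exact mul_inv_cancel₀ hz0.ne'
    rw [Complex.norm_sub_sq_eq, Complex.norm_sub_sq_eq, h3, h4]
    set a := (u * (starRingEnd ℂ) z).re
    have h5 : ‖z‖⁻¹ ≤ 1 := inv_le_one_of_one_le₀ hz
    have h6 : a * (1 - ‖z‖⁻¹) ≤ ‖z‖ * (1 - ‖z‖⁻¹) :=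
      mul_le_mul_of_nonneg_right h2 (by linarith)
    have h7 : ‖z‖ * ‖z‖⁻¹ = 1 := mul_inv_cancel₀ hz0.ne'
    nlinarith [sq_nonneg (‖z‖ - 1)]

/-- A polynomial in `z` and `conj z` which is close to the projection to the unit disc. -/
theorem exists_polynomial_clamp {δ : ℝ} (hδ : 0 < δ) : ∃ q : Polynomial ℝ, ∀ z : ℂ, ‖z‖ ≤ 3 →
    ‖z * (q.eval (‖z‖ ^ 2) : ℝ)‖ ≤ 2 ∧
      ∀ u : ℂ, ‖u‖ ≤ 1 → ‖u - z * (q.eval (‖z‖ ^ 2) : ℝ)‖ ^ 2 ≤ ‖u - z‖ ^ 2 + δ := by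
  -- Weierstrass approximation of the clamping factor as a function of `‖z‖ ^ 2 ∈ [0, 9]`. An error
  -- `η` in the factor moves the clamped point by at most `3 * η` and the squared distance by at
  -- most `12 * η + 9 * η ^ 2 ≤ 30 * η`.
  obtain ⟨q, hq⟩ := exists_polynomial_near_of_continuousOn 0 9 (fun s => (max 1 (√s))⁻¹)
    (by
      refine Continuous.continuousOn (Continuous.inv₀ (by fun_prop) fun s => ?_)
      positivity) (min 1 δ / 30) (by positivity)
  refine ⟨q, fun z hz => ?_⟩
  set η := min 1 δ / 30 with hη
  have hη1 : η ≤ 1 / 30 := by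
    have := min_le_left 1 δ
    rw [hη]; linarith
  have hηδ : 30 * η ≤ δ := by
    have := min_le_right 1 δ
    rw [hη]; linarith
  have h := hq (‖z‖ ^ 2) ⟨by positivity, by nlinarith [norm_nonneg z]⟩
  rw [Real.sqrt_sq (norm_nonneg z)] at h
  have hd : ‖z * (q.eval (‖z‖ ^ 2) : ℝ) - z * ((max 1 ‖z‖)⁻¹ : ℝ)‖ ≤ 3 * η := by
    rw [← mul_sub, ← Complex.ofReal_sub, norm_mul, Complex.norm_real]
    exact mul_le_mul hz h.le (norm_nonneg _) (by norm_num)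
  have hcl : ‖z * ((max 1 ‖z‖)⁻¹ : ℝ)‖ ≤ 1 := by
    have hpos : 0 < max 1 ‖z‖ := lt_of_lt_of_le one_pos (le_max_left _ _)
    rw [norm_mul, Complex.norm_real, Real.norm_of_nonneg (by positivity), ← div_eq_mul_inv,
      div_le_one hpos]
    exact le_max_right _ _
  set w := z * (q.eval (‖z‖ ^ 2) : ℝ)
  set c := z * ((max 1 ‖z‖)⁻¹ : ℝ)
  refine ⟨?_, fun u hu => ?_⟩
  · have := norm_le_norm_add_norm_sub' w c
    linarith
  · have h1 : ‖u - w‖ ≤ ‖u - c‖ + 3 * η := by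
      have := norm_sub_le_norm_sub_add_norm_sub u c w
      rw [norm_sub_rev c w] at this
      linarith
    have h2 : ‖u - c‖ ≤ 2 := (norm_sub_le _ _).trans (by linarith)
    have h3 : ‖u - c‖ ≤ ‖u - z‖ := norm_sub_clamp_le hu
    have h4 : ‖u - w‖ ^ 2 ≤ (‖u - c‖ + 3 * η) ^ 2 := pow_le_pow_left₀ (norm_nonneg _) h1 2
    have h5 : ‖u - c‖ ^ 2 ≤ ‖u - z‖ ^ 2 := pow_le_pow_left₀ (norm_nonneg _) h3 2
    have hη0 : 0 < η := by positivity
    nlinarith [norm_nonneg (u - c)]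

end Truncation

/-! ### Energy decrement -/

section Energy

/-- Closure properties of a family of classes `C M` of functions of complexity at most `M`. -/
structure IsComplexityClass {ι X : Type*} [MeasurableSpace X] (C : ℝ → (ι → X → ℂ) → Prop) :
    Prop where
  measurable : ∀ {M φ}, C M φ → ∀ i, Measurable (φ i)
  mono : ∀ {M M' φ}, C M φ → M ≤ M' → C M' φ
  add : ∀ {M M' φ ψ}, C M φ → C M' ψ → C (M + M') fun i x => φ i x + ψ i x
  smul : ∀ {M φ}, C M φ → ∀ a : ℂ, C (‖a‖ * M) fun i x => a * φ i x
  mul : ∀ {M M' φ ψ}, C M φ → C M' ψ → C (3 * (M * M')) fun i x => φ i x * ψ i x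
  conj : ∀ {M φ}, C M φ → C M fun i x => (starRingEnd ℂ) (φ i x)

universe u v

/-- Truncation by a polynomial in `z` and `conj z` uses only sums, products and conjugates, so the
complexity stays bounded. The bound `Φ` must not depend on the class or on the family, as it enters
the constants of the final theorem. -/
theorem exists_complexity_polynomial (q : Polynomial ℝ) : ∃ Φ : ℝ → ℝ,
    ∀ {ι : Type u} {X : Type v} [MeasurableSpace X] {C : ℝ → (ι → X → ℂ) → Prop},
      IsComplexityClass C → ∀ {M φ}, C M φ →
        C (Φ M) fun i x => φ i x * (q.eval (‖φ i x‖ ^ 2) : ℝ) := by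
  induction q using Polynomial.induction_on' with
  | add p q hp hq =>
    obtain ⟨Φ, h⟩ := hp
    obtain ⟨Φ', h'⟩ := hq
    refine ⟨fun M => Φ M + Φ' M, fun hC M φ hφ => ?_⟩
    convert hC.add (h hC hφ) (h' hC hφ) using 3
    push_cast [Polynomial.eval_add]
    ring
  | monomial n a =>
    suffices ∃ Φ : ℝ → ℝ, ∀ {ι : Type u} {X : Type v} [MeasurableSpace X]
        {C : ℝ → (ι → X → ℂ) → Prop}, IsComplexityClass C → ∀ {M φ}, C M φ →
          C (Φ M) fun i x => φ i x * ((‖φ i x‖ ^ 2) ^ n : ℝ) by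
      obtain ⟨Φ, h⟩ := this
      refine ⟨fun M => ‖(a : ℂ)‖ * Φ M, fun hC M φ hφ => ?_⟩
      convert hC.smul (h hC hφ) a using 3
      push_cast [Polynomial.eval_monomial]
      ring
    induction n with
    | zero => exact ⟨id, fun hC M φ hφ => by simpa using hφ⟩
    | succ n ih =>
      obtain ⟨Φ, h⟩ := ih
      refine ⟨fun M => 3 * (Φ M * (3 * (M * M))), fun hC M φ hφ => ?_⟩
      convert hC.mul (h hC hφ) (hC.mul hφ (hC.conj hφ)) using 3
      rw [Complex.mul_conj']
      push_cast
      ring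

theorem integrable_of_bounded {X : Type*} [MeasurableSpace X] {μ : Measure X}
    [IsProbabilityMeasure μ] {E : Type*} [NormedAddCommGroup E] {f : X → E}
    (hf : AEStronglyMeasurable f μ) (R : ℝ) (h : ∀ x, ‖f x‖ ≤ R) : Integrable f μ :=
  (memLp_top_of_bound hf R (Eventually.of_forall h)).integrable le_top

/-- Moving `g` by `t * ψ`, with the phase of `t` aligned to the correlation, gains at least `2 * κ ^
2` in the linear term. It costs `κ ^ 2` in the quadratic term and `κ ^ 2 / 2` for the truncation
that makes the new approximant bounded again. -/
theorem energy_decrement {ι X : Type*} [Fintype ι] [Nonempty ι] [MeasurableSpace X]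
    {μ : Measure X} [IsProbabilityMeasure μ] {κ : ℝ} (hκ : 0 < κ)
    {q : Polynomial ℝ} (hq : ∀ z : ℂ, ‖z‖ ≤ 3 → ∀ u : ℂ, ‖u‖ ≤ 1 →
      ‖u - z * (q.eval (‖z‖ ^ 2) : ℝ)‖ ^ 2 ≤ ‖u - z‖ ^ 2 + κ ^ 2 / 2)
    {u g ψ : ι → X → ℂ} (hu : ∀ i, UnitBdd (u i)) (hg : ∀ i, Measurable (g i))
    (hg2 : ∀ i x, ‖g i x‖ ≤ 2) (hψ : ∀ i, UnitBdd (ψ i)) {t : ℂ}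
    (ht : (starRingEnd ℂ) t * (𝔼 i, ∫ x, (u i x - g i x) * (starRingEnd ℂ) (ψ i x) ∂μ) =
      (κ * ‖𝔼 i, ∫ x, (u i x - g i x) * (starRingEnd ℂ) (ψ i x) ∂μ‖ : ℝ)) (htκ : ‖t‖ = κ)
    (hκ1 : κ ≤ 1) (hbig : κ ≤ ‖𝔼 i, ∫ x, (u i x - g i x) * (starRingEnd ℂ) (ψ i x) ∂μ‖) :
    𝔼 i, ∫ x, ‖u i x - (g i x + t * ψ i x) * (q.eval (‖g i x + t * ψ i x‖ ^ 2) : ℝ)‖ ^ 2 ∂μ ≤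
      (𝔼 i, ∫ x, ‖u i x - g i x‖ ^ 2 ∂μ) - κ ^ 2 / 2 := by
  have hz : ∀ i x, ‖g i x + t * ψ i x‖ ≤ 3 := fun i x => by
    refine (norm_add_le _ _).trans ?_
    rw [norm_mul, htκ]
    have := mul_le_one₀ hκ1 (norm_nonneg _) ((hψ i).norm_le x)
    linarith [hg2 i x]
  have hW : ∀ i, Integrable (fun x => (u i x - g i x) * (starRingEnd ℂ) (ψ i x)) μ := fun i =>
    integrable_of_bounded ((((hu i).measurable.sub (hg i)).mul
      (hψ i).conj.measurable).aestronglyMeasurable) 3 fun x => by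
      refine (norm_mul _ _).le.trans ((mul_le_of_le_one_right (norm_nonneg _)
        ((hψ i).conj.norm_le x)).trans ((norm_sub_le _ _).trans ?_))
      linarith [(hu i).norm_le x, hg2 i x]
  have hA : ∀ i, Integrable (fun x => ‖u i x - g i x‖ ^ 2) μ := fun i =>
    integrable_of_bounded ((((hu i).measurable.sub (hg i)).norm.pow_const
      2).aestronglyMeasurable) 9 fun x => by
      have : ‖u i x - g i x‖ ≤ 3 := (norm_sub_le _ _).trans (by
        linarith [(hu i).norm_le x, hg2 i x])
      rw [Real.norm_of_nonneg (by positivity)]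
      nlinarith [norm_nonneg (u i x - g i x)]
  have hpt : ∀ i x, ‖u i x - (g i x + t * ψ i x) *
      (q.eval (‖g i x + t * ψ i x‖ ^ 2) : ℝ)‖ ^ 2 ≤ ‖u i x - g i x‖ ^ 2 -
        2 * Complex.reCLM ((starRingEnd ℂ) t * ((u i x - g i x) * (starRingEnd ℂ) (ψ i x))) +
        3 / 2 * κ ^ 2 := by
    intro i x
    refine (hq _ (hz i x) _ ((hu i).norm_le x)).trans ?_
    rw [← sub_sub, Complex.norm_sub_sq_eq, norm_mul, htκ, map_mul, Complex.reCLM_apply,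
      mul_left_comm ((starRingEnd ℂ) t)]
    have h1 := (hψ i).norm_le x
    have h2 : (κ * ‖ψ i x‖) ^ 2 ≤ κ ^ 2 := by
      have := mul_le_of_le_one_right hκ.le h1
      exact pow_le_pow_left₀ (by positivity) this 2
    linarith
  have hint : ∀ i, ∫ x, ‖u i x - (g i x + t * ψ i x) *
      (q.eval (‖g i x + t * ψ i x‖ ^ 2) : ℝ)‖ ^ 2 ∂μ ≤ ∫ x, ‖u i x - g i x‖ ^ 2 ∂μ -
        2 * ((starRingEnd ℂ) t * ∫ x, (u i x - g i x) * (starRingEnd ℂ) (ψ i x) ∂μ).re +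
        3 / 2 * κ ^ 2 := by
    intro i
    have hre : Integrable (fun x => 2 * Complex.reCLM ((starRingEnd ℂ) t *
        ((u i x - g i x) * (starRingEnd ℂ) (ψ i x)))) μ :=
      (Complex.reCLM.integrable_comp ((hW i).const_mul _)).const_mul 2
    have hs : Integrable (fun x => ‖u i x - g i x‖ ^ 2 - 2 * Complex.reCLM ((starRingEnd ℂ) t *
        ((u i x - g i x) * (starRingEnd ℂ) (ψ i x)))) μ := (hA i).sub hre
    calc _ ≤ ∫ x, (‖u i x - g i x‖ ^ 2 -
        2 * Complex.reCLM ((starRingEnd ℂ) t * ((u i x - g i x) * (starRingEnd ℂ) (ψ i x))) +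
        3 / 2 * κ ^ 2) ∂μ :=
          integral_mono_of_nonneg (Eventually.of_forall fun x => by positivity)
            (hs.add (integrable_const _)) (Eventually.of_forall fun x => hpt i x)
      _ = _ := by
        rw [integral_add hs (integrable_const _)]
        rw [integral_sub (hA i) hre, integral_const_mul,
          Complex.reCLM.integral_comp_comm ((hW i).const_mul _), integral_const_mul]
        simp
  refine (Finset.expect_le_expect fun i _ => hint i).trans ?_
  rw [Finset.expect_add_distrib, Finset.expect_sub_distrib, Fintype.expect_const,
    ← Finset.mul_expect, ← re_expect, ← Finset.mul_expect, ht, Complex.ofReal_re]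
  nlinarith

/-- Every bounded family of functions has a bounded approximation of bounded complexity, such that
the difference is almost orthogonal to all bounded functions of much larger complexity. -/
theorem exists_bounded_approx (Φ : ℝ → ℝ) {κ : ℝ} (hκ : 0 < κ) (hκ1 : κ ≤ 1) :
    ∃ (N : ℕ) (K : ℕ → ℝ), (∀ m, 0 ≤ K m) ∧
      ∀ {ι : Type u} {X : Type v} [Fintype ι] [Nonempty ι] [MeasurableSpace X]
        (μ : Measure X) [IsProbabilityMeasure μ] (C : ℕ → ℝ → (ι → X → ℂ) → Prop),
        (∀ m, IsComplexityClass (C m)) → (∀ m M φ, C m M φ → C (m + 1) M φ) →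
        C 0 0 (fun _ _ => 0) → ∀ u : ι → X → ℂ, (∀ i, UnitBdd (u i)) →
        ∃ m < N, ∃ g, C m (K m) g ∧ (∀ i x, ‖g i x‖ ≤ 2) ∧
          ∀ ψ, C (m + 1) (Φ (K m)) ψ → (∀ i x, ‖ψ i x‖ ≤ 1) →
            ‖𝔼 i, ∫ x, (u i x - g i x) * (starRingEnd ℂ) (ψ i x) ∂μ‖ ≤ κ := by
  obtain ⟨q, hq⟩ := exists_polynomial_clamp (δ := κ ^ 2 / 2) (by positivity)
  obtain ⟨Ψ, hΨ⟩ := exists_complexity_polynomial.{u, v} q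
  -- The next approximant is the truncation of `g + t * ψ`, where `ψ` has complexity `Φ M` and `‖t‖
  -- = κ`. The initial squared distance is at most `1` and each step removes `κ ^ 2 / 2`, so fewer
  -- than `N > 2 / κ ^ 2` steps are possible.
  let K : ℕ → ℝ := fun m => Nat.rec 0 (fun _ M => |Ψ (M + κ * Φ M)|) m
  obtain ⟨N, hN⟩ := exists_nat_gt (2 / κ ^ 2)
  refine ⟨N, K, fun m => ?_, ?_⟩
  · cases m
    · exact le_rfl
    · exact abs_nonneg _
  intro ι X _ _ _ μ _ C hC hCm hC0 u hu
  by_contra! hno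
  have key : ∀ m ≤ N, ∃ g, C m (K m) g ∧ (∀ i x, ‖g i x‖ ≤ 2) ∧
      𝔼 i, ∫ x, ‖u i x - g i x‖ ^ 2 ∂μ ≤ 1 - m * (κ ^ 2 / 2) := by
    intro m
    induction m with
    | zero =>
      intro _
      refine ⟨_, hC0, by simp, ?_⟩
      simp only [sub_zero, Nat.cast_zero, zero_mul]
      refine Finset.expect_le Finset.univ_nonempty fun i _ => ?_
      have : ∫ x, ‖u i x‖ ^ 2 ∂μ ≤ ∫ _, (1 : ℝ) ∂μ :=
        integral_mono_of_nonneg (Eventually.of_forall fun x => by positivity)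
          (integrable_const _) (Eventually.of_forall fun x =>
            pow_le_one₀ (norm_nonneg _) ((hu i).norm_le x))
      simpa using this
    | succ m ih =>
      intro hm
      obtain ⟨g, hg, hg2, hE⟩ := ih (by omega)
      obtain ⟨ψ, hψ, hψ1, hbig⟩ := hno m (by omega) g hg hg2
      set z := 𝔼 i, ∫ x, (u i x - g i x) * (starRingEnd ℂ) (ψ i x) ∂μ with hz
      have hz0 : ‖z‖ ≠ 0 := (hκ.trans hbig).ne'
      have ht : ‖(κ : ℂ) * (z / ‖z‖)‖ = κ := by
        rw [norm_mul, norm_div, Complex.norm_real, Complex.norm_real, norm_norm, div_self hz0,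
          mul_one, Real.norm_of_nonneg hκ.le]
      have hadd := (hC (m + 1)).add (hCm _ _ _ hg) ((hC (m + 1)).smul hψ ((κ : ℂ) * (z / ‖z‖)))
      rw [ht] at hadd
      refine ⟨_, (hC (m + 1)).mono (hΨ (hC (m + 1)) hadd) (le_abs_self _), fun i x =>
        (hq _ ?_).1, (energy_decrement hκ (fun w hw => (hq w hw).2) hu ((hC m).measurable hg) hg2
          (fun i => ⟨(hC (m + 1)).measurable hψ i, hψ1 i⟩) ?_ ht hκ1 hbig.le).trans ?_⟩
      · refine (norm_add_le _ _).trans ?_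
        rw [norm_mul, ht]
        have := mul_le_one₀ hκ1 (norm_nonneg _) (hψ1 i x)
        linarith [hg2 i x]
      · rw [← hz]
        have : (‖z‖ : ℂ) ≠ 0 := by exact_mod_cast hz0
        simp only [map_mul, map_div₀, Complex.conj_ofReal]
        push_cast
        rw [mul_assoc, div_mul_eq_mul_div, mul_comm ((starRingEnd ℂ) z), Complex.mul_conj',
          pow_two, mul_div_cancel_right₀ _ this]
      · push_cast
        linarith
  obtain ⟨g, -, -, hE⟩ := key N le_rfl
  have h0 : 0 ≤ 𝔼 i, ∫ x, ‖u i x - g i x‖ ^ 2 ∂μ :=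
    Finset.expect_nonneg fun i _ => integral_nonneg fun x => by positivity
  rw [div_lt_iff₀ (by positivity)] at hN
  linarith

end Energy

/-! ### Structured families form complexity classes -/

section Classes

variable {G X κ ι : Type*} [AddCommGroup G] [AddAction G X] [MeasurableSpace X] [Fintype κ]
  [DecidableEq κ]

theorem IsComplexityClass.and {C C' : ℝ → (ι → X → ℂ) → Prop} (h : IsComplexityClass C)
    (h' : IsComplexityClass C') : IsComplexityClass fun M φ => C M φ ∧ C' M φ where
  measurable hφ := h.measurable hφ.1
  mono hφ hM := ⟨h.mono hφ.1 hM, h'.mono hφ.2 hM⟩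
  add hφ hψ := ⟨h.add hφ.1 hψ.1, h'.add hφ.2 hψ.2⟩
  smul hφ a := ⟨h.smul hφ.1 a, h'.smul hφ.2 a⟩
  mul hφ hψ := ⟨h.mul hφ.1 hψ.1, h'.mul hφ.2 hψ.2⟩
  conj hφ := ⟨h.conj hφ.1, h'.conj hφ.2⟩

theorem isComplexityClass_isStr {τ : ℝ} (hτ : 0 ≤ τ) (hτ1 : τ ≤ 1) (A : ι → κ → Set G) :
    IsComplexityClass fun M (φ : ι → X → ℂ) => ∀ i, IsStr (A i) τ M (φ i) where
  measurable hφ i := (hφ i).measurable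
  mono hφ hM i := (hφ i).mono (fun _ => subset_rfl) hτ hM
  add hφ hψ i := (hφ i).add (hψ i)
  smul hφ a i := (hφ i).smul a
  mul hφ hψ i := (hφ i).mul (hψ i) hτ hτ1
  conj hφ i := (hφ i).conj

theorem IsStr.zero {A : κ → Set G} {τ M : ℝ} (hτ : 0 ≤ τ) (hM : 0 ≤ M) :
    IsStr A τ M fun _ : X => (0 : ℂ) :=
  ⟨measurable_const, 0, Fin.elim0, Fin.elim0, by simpa using hM, fun s => s.elim0,
    fun s => s.elim0, fun e _ x => by simpa using mul_nonneg hM hτ⟩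

theorem ShiftInv.mono {A : Multiset G} {e : G} {δ δ' : ℝ} (h : ShiftInv A e δ) (hδ : δ ≤ δ') :
    ShiftInv A e δ' := fun φ hφ => (h φ hφ).trans hδ

end Classes

/-! ### Structure along dilates of coset progressions -/

section Progressions

variable {G X : Type*} [AddCommGroup G] [AddAction G X] [MeasurableSpace X] {μ : Measure X}
  {d r : ℕ}

/-- The elements of the dilates of the members of a family of coset progressions. -/
def dilateSet (Q : Fin d → CosetProgression G) (s : ℝ) (k : Fin d) : Set G :=
  {g | g ∈ (Q k).dilate s}

/-- The sums of elements of the dilates of the members of two families of coset progressions. -/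
def dilateAddSet (Q Q' : Fin d → CosetProgression G) (s : ℝ) (p : Fin d × Fin d) : Set G :=
  {g | g ∈ sumset ((Q p.1).dilate s) ((Q' p.2).dilate s)}

theorem mem_sumset {A B : Multiset G} {g : G} : g ∈ sumset A B ↔ ∃ a ∈ A, ∃ b ∈ B, a + b = g := by
  simp only [sumset, Multiset.mem_map, Multiset.mem_product, Prod.exists]
  tauto

theorem dilateSet_mono (Q : Fin d → CosetProgression G) {s s' : ℝ} (h : s ≤ s') (k : Fin d) :
    dilateSet Q s k ⊆ dilateSet Q s' k := fun _ hg => (Q k).mem_dilate_mono h hg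

theorem dilateAddSet_mono (Q Q' : Fin d → CosetProgression G) {s s' : ℝ} (h : s ≤ s')
    (p : Fin d × Fin d) : dilateAddSet Q Q' s p ⊆ dilateAddSet Q Q' s' p := by
  intro g hg
  obtain ⟨a, ha, b, hb, rfl⟩ := mem_sumset.1 hg
  exact mem_sumset.2 ⟨a, (Q p.1).mem_dilate_mono h ha, b, (Q' p.2).mem_dilate_mono h hb, rfl⟩

theorem shiftInv_neg_of_mem_dilate {Q : CosetProgression G} (hr : Q.rank ≤ r) {s τ : ℝ}
    (hs : 0 < s) (hτ : 0 ≤ τ) {g : G} (hg : g ∈ Q.dilate (τ * s)) :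
    ShiftInv (Q.dilate s) (-g) (r * (2 * τ)) := by
  refine (Q.shiftInv_dilate hs hτ (Q.mem_dilate_neg hg)).mono ?_
  gcongr

/-- A bound for the complexity of the dual function of a function of complexity `M`. -/
def dualBound (d r : ℕ) (M : ℝ) : ℝ := (3 * M) ^ (2 ^ d - 1) + 2 * r * d + 2 * r * d * d

theorem dualBound_mono {M M' : ℝ} (hM : 0 ≤ M) (h : M ≤ M') : dualBound d r M ≤ dualBound d r M' := by
  unfold dualBound
  gcongr

theorem UnitBdd.isStr_boxDual_dilate (hμ : IsGSystem G μ) {f : X → ℂ} (hf : UnitBdd f) {τ s : ℝ}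
    (hτ : 0 ≤ τ) (hτ1 : τ ≤ 1) (hs : 0 < s) {Q : Fin d → CosetProgression G}
    (hQ : ∀ k, (Q k).rank ≤ r) :
    IsStr (dilateSet Q (τ * s)) τ (dualBound d r 1) (_root_.boxDual (fun k => (Q k).dilate s) f) := by
  have := hf.isStr_boxDual hμ hτ hτ1 (A := fun k => (Q k).dilate s)
    (fun k => (Q k).dilate_ne_zero hs.le) (E := dilateSet Q (τ * s)) (δ := r * (2 * τ))
    (K := 2 * r * d) (by positivity) (le_of_eq (by ring)) (by positivity)
    fun k g hg => shiftInv_neg_of_mem_dilate (hQ k) hs hτ hg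
  refine this.mono (fun _ => subset_rfl) hτ ?_
  rw [dualBound, mul_one]
  have : (0 : ℝ) ≤ 2 * r * d * d := by positivity
  linarith

theorem IsStr.boxDual_dilate (hμ : IsGSystem G μ) {f : X → ℂ} (hf : UnitBdd f) {τ s M : ℝ}
    (hτ : 0 ≤ τ) (hτ1 : τ ≤ 1) (hs : 0 < s) {Q Q' : Fin d → CosetProgression G}
    (hQ : ∀ k, (Q k).rank ≤ r) (hfs : IsStr (dilateSet Q' (τ * s)) τ M f) :
    IsStr (dilateSet Q' (τ * s)) τ (dualBound d r M) (_root_.boxDual (fun k => (Q k).dilate s) f) ∧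
    IsStr (dilateAddSet Q Q' (τ * s)) τ (dualBound d r M)
      (_root_.boxDual (fun k => (Q k).dilate s) f) := by
  have h0 : (0 : ℝ) ≤ 2 * r * d * d := by positivity
  have h1 : (0 : ℝ) ≤ 2 * r * d := by positivity
  have hA : ∀ k, (Q k).dilate s ≠ 0 := fun k => (Q k).dilate_ne_zero hs.le
  constructor
  · refine (hfs.boxDual hμ hτ hτ1 hA).mono (fun _ => subset_rfl) hτ ?_
    rw [dualBound]
    linarith
  · refine (hfs.boxDual_add hμ hf hτ hτ1 hA (C := dilateAddSet Q Q' (τ * s)) (δ := r * (2 * τ))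
      (K := 2 * r * d * d) (by positivity) (le_of_eq (by simp; ring)) (by positivity)
      fun k l g hg => ?_).mono (fun _ => subset_rfl) hτ ?_
    · obtain ⟨a, ha, b, hb, rfl⟩ := mem_sumset.1 hg
      exact ⟨a, b, shiftInv_neg_of_mem_dilate (hQ k) hs hτ ha, hb, rfl⟩
    · rw [dualBound]
      linarith

universe u v

/-- A bounded function which is structured along `Q'` is approximated, up to an error almost
orthogonal to a given function structured along `Q`, by bounded functions which are structured
along `Q` and along the sums of `Q` and `Q'`. -/
theorem exists_approx_of_isStr (d r : ℕ) {κ : ℝ} (hκ : 0 < κ) (M : ℝ) :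
    ∃ M' τ₀ : ℝ, 0 ≤ M' ∧ 0 < τ₀ ∧ ∀ {G : Type u} {X : Type v} [AddCommGroup G] [AddAction G X]
      [MeasurableSpace X] (μ : Measure X), IsGSystem G μ → ∀ {Q Q' : Fin d → CosetProgression G},
      (∀ k, (Q k).rank ≤ r) → ∀ {τ s : ℝ}, 0 < τ → τ ≤ 1 → τ ≤ τ₀ → 0 < s → ∀ {φ φ' : X → ℂ},
      IsStr (dilateSet Q s) τ M φ → IsStr (dilateSet Q' s) τ M φ' → (∀ x, ‖φ' x‖ ≤ 2) →
      ∃ g : X → ℂ, IsStr (dilateSet Q (τ * s)) τ M' g ∧ IsStr (dilateAddSet Q Q' (τ * s)) τ M' g ∧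
        (∀ x, ‖g x‖ ≤ 4) ∧ ‖∫ x, φ x * (starRingEnd ℂ) (φ' x - g x) ∂μ‖ ≤ κ := by
  by_cases hM : M < 0
  · exact ⟨0, 1, le_rfl, one_pos, fun μ _ Q Q' _ τ s _ _ _ _ φ φ' hφ =>
      absurd hφ.rep.nonneg (not_le.2 hM)⟩
  rw [not_lt] at hM
  -- The final error is `6 * M * (boxNorm w + τ)`, and both summands will be at most `θ`.
  set θ := κ / (12 * (M + 1)) with hθ
  have hθ0 : 0 < θ := by positivity
  obtain ⟨N, K, hK, h⟩ := exists_bounded_approx.{0, v} (fun K => dualBound d r (K + M + 1))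
    (κ := min 1 (θ ^ 2 ^ d)) (by positivity) (min_le_left _ _)
  refine ⟨2 * ∑ m ∈ Finset.range N, K m, θ, ?_, hθ0, ?_⟩
  · exact mul_nonneg zero_le_two (Finset.sum_nonneg fun m _ => hK m)
  intro G X _ _ _ μ hμ Q Q' hQ τ s hτ hτ1 hτθ hs φ φ' hφ hφ' hφ'2
  have := hμ.isProbabilityMeasure
  have hts : τ * s ≤ s := mul_le_of_le_one_left hs.le hτ1
  have hu : UnitBdd fun x => (1 / 2 : ℂ) * φ' x := ⟨hφ'.measurable.const_mul _, fun x => by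
    rw [norm_mul]
    norm_num
    linarith [hφ'2 x]⟩
  -- All three kinds of structure are kept together. The first and the third are wanted for `g`; the
  -- one along `Q'` makes the error `w` structured along `Q'`, so that its dual function along `Q`
  -- is structured along the sums.
  have hcl : IsComplexityClass fun M (φ : Unit → X → ℂ) =>
      (∀ i, IsStr (dilateSet Q (τ * s)) τ M (φ i)) ∧ (∀ i, IsStr (dilateSet Q' (τ * s)) τ M (φ i)) ∧
        ∀ i, IsStr (dilateAddSet Q Q' (τ * s)) τ M (φ i) :=
    (isComplexityClass_isStr hτ.le hτ1 fun _ => dilateSet Q (τ * s)).and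
      ((isComplexityClass_isStr hτ.le hτ1 fun _ => dilateSet Q' (τ * s)).and
      (isComplexityClass_isStr hτ.le hτ1 fun _ => dilateAddSet Q Q' (τ * s)))
  -- The class is the same at every step, so no scale is lost in this decrement: the dual functions
  -- are always taken at scale `s` and are structured at scale `τ * s`.
  obtain ⟨m, hm, g, ⟨hg1, hg2, hg3⟩, hgb, horth⟩ := h μ (fun _ => _) (fun _ => hcl)
    (fun _ _ _ h => h) ⟨fun _ => IsStr.zero hτ.le le_rfl, fun _ => IsStr.zero hτ.le le_rfl,
      fun _ => IsStr.zero hτ.le le_rfl⟩ (fun _ x => (1 / 2 : ℂ) * φ' x) fun _ => hu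
  have hKm : K m ≤ ∑ m ∈ Finset.range N, K m :=
    Finset.single_le_sum (fun m _ => hK m) (Finset.mem_range.2 hm)
  have h2g : ∀ {A : Fin d → Set G}, IsStr A τ (K m) (g ()) →
      IsStr A τ (2 * ∑ m ∈ Finset.range N, K m) fun x => 2 * g () x := fun hA =>
    (hA.smul 2).mono (fun _ => subset_rfl) hτ.le (by simpa using hKm)
  have h2g' : IsStr (dilateAddSet Q Q' (τ * s)) τ (2 * ∑ m ∈ Finset.range N, K m)
      fun x => 2 * g () x :=
    ((hg3 ()).smul 2).mono (fun _ => subset_rfl) hτ.le (by simpa using hKm)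
  refine ⟨fun x => 2 * g () x, h2g (hg1 ()), h2g', fun x => ?_, ?_⟩
  · rw [norm_mul]
    norm_num
    linarith [hgb () x]
  -- The bounds `1` for `1 / 2 * φ'` and `2` for `g` account for the factor `1 / 3`.
  let w : X → ℂ := fun x => (1 / 3 : ℂ) * ((1 / 2 : ℂ) * φ' x + (-1) * g () x)
  have hw : UnitBdd w := ⟨((hu.measurable.add ((hg1 ()).measurable.const_mul _)).const_mul _),
    fun x => by
      simp only [w]
      rw [norm_mul]
      have := norm_add_le ((1 / 2 : ℂ) * φ' x) ((-1) * g () x)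
      have h1 := hu.norm_le x
      have h2 := hgb () x
      rw [norm_mul (-1 : ℂ)] at this
      norm_num at this h1 ⊢
      linarith⟩
  have hws : IsStr (dilateSet Q' (τ * s)) τ (K m + M + 1) w := by
    have h1 : IsStr (dilateSet Q' (τ * s)) τ M φ' :=
      hφ'.mono (dilateSet_mono Q' hts) hτ.le le_rfl
    refine (((h1.smul (1 / 2)).add ((hg2 ()).smul (-1))).smul (1 / 3)).mono
      (fun _ => subset_rfl) hτ.le ?_
    have := hK m
    norm_num
    linarith
  -- The dual function of `w` lies in all three classes and is therefore an admissible test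
  -- function. Orthogonality to it makes the box norm of `w` along `Q` small, and hence also the
  -- correlation of `w` with `φ`, which is structured along `Q`.
  have hd1 := (hw.isStr_boxDual_dilate hμ hτ.le hτ1 hs hQ).mono (fun _ => subset_rfl) hτ.le
    (dualBound_mono zero_le_one (by linarith [hK m] : 1 ≤ K m + M + 1))
  obtain ⟨hd2, hd3⟩ := hws.boxDual_dilate hμ hw hτ.le hτ1 hs hQ
  have horth' := horth (fun _ x => (starRingEnd ℂ) (boxDual (fun k => (Q k).dilate s) w x))
    ⟨fun _ => hd1.conj, fun _ => hd2.conj, fun _ => hd3.conj⟩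
    fun _ => (hw.boxDual hμ _).conj.norm_le
  have hbox : boxNorm μ (List.ofFn fun k => (Q k).dilate s) w ≤ θ := by
    have e1 : ∀ x, ((1 / 2 : ℂ) * φ' x - g () x) *
        boxDual (fun k => (Q k).dilate s) w x = 3 * (w x * boxDual (fun k => (Q k).dilate s) w x) :=
      fun x => by simp only [w]; ring
    simp only [Finset.univ_unique, PUnit.default_eq_unit, Finset.expect_singleton,
      Complex.conj_conj, e1] at horth'
    rw [integral_const_mul, ← boxAvg_eq_integral_mul_boxDual hμ _ hw, norm_mul] at horth'
    rw [boxNorm, List.length_ofFn, one_div, Real.rpow_inv_le_iff_of_pos (norm_nonneg _) hθ0.le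
      (by positivity)]
    have h3 := horth'.trans (min_le_right _ _)
    norm_num at h3
    have : ‖boxAvg μ (List.ofFn fun k => (Q k).dilate s) w‖ ≤ θ ^ 2 ^ d := by
      linarith [norm_nonneg (boxAvg μ (List.ofFn fun k => (Q k).dilate s) w)]
    exact_mod_cast this
  have hcorr := hφ.conj.norm_integral_mul_le hμ hw (A' := fun k => (Q k).dilate s)
    (fun k => (Q k).dilate_ne_zero hs.le) (fun k a ha => ha) hτ.le
  have e2 : ∀ x, φ x * (starRingEnd ℂ) (φ' x - 2 * g () x) =
      (starRingEnd ℂ) (6 * (w x * (starRingEnd ℂ) (φ x))) := fun x => by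
    simp only [w, map_mul, map_add, map_sub, map_neg, map_div₀, map_one, map_ofNat,
      Complex.conj_conj]
    ring
  simp only [e2]
  rw [integral_conj, RCLike.norm_conj, integral_const_mul, norm_mul]
  have h1 : M * (boxNorm μ (List.ofFn fun k => (Q k).dilate s) w + τ) ≤ M * (2 * θ) :=
    mul_le_mul_of_nonneg_left (by linarith) hM
  have h2 : (M + 1) * (12 * θ) = κ := by
    rw [hθ]
    field_simp
  norm_num
  nlinarith

end Progressions

/-! ### The Bessel argument -/

section Core

variable {I X : Type*} [Fintype I] [MeasurableSpace X] {μ : Measure X}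
  [IsProbabilityMeasure μ]

theorem integrable_mul_of_bounded {f g : X → ℂ} (hf : Measurable f) (hg : Measurable g) {a b : ℝ}
    (hfa : ∀ x, ‖f x‖ ≤ a) (hgb : ∀ x, ‖g x‖ ≤ b) : Integrable (fun x => f x * g x) μ :=
  integrable_of_bounded (hf.mul hg).aestronglyMeasurable (a * b) fun x => by
    rw [norm_mul]
    exact mul_le_mul (hfa x) (hgb x) (norm_nonneg _) ((norm_nonneg _).trans (hfa x))

theorem measurable_conj {f : X → ℂ} (hf : Measurable f) :
    Measurable fun x => (starRingEnd ℂ) (f x) :=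
  Complex.continuous_conj.measurable.comp hf

theorem expect_integral_sub_mul {f : X → ℂ} {φ ψ : I → X → ℂ} (hf : UnitBdd f)
    (hφ : ∀ i, Measurable (φ i)) (hφ2 : ∀ i x, ‖φ i x‖ ≤ 2) (hψ : ∀ i, Measurable (ψ i)) {b : ℝ}
    (hψb : ∀ i x, ‖ψ i x‖ ≤ b) :
    𝔼 i, ∫ x, (f x - φ i x) * ψ i x ∂μ =
      (𝔼 i, ∫ x, f x * ψ i x ∂μ) - 𝔼 i, ∫ x, φ i x * ψ i x ∂μ := by
  rw [← Finset.expect_sub_distrib]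
  refine Finset.expect_congr rfl fun i _ => ?_
  simp only [sub_mul]
  exact integral_sub (integrable_mul_of_bounded hf.measurable (hψ i) hf.norm_le (hψb i))
    (integrable_mul_of_bounded (hφ i) (hψ i) (hφ2 i) (hψb i))

/-- If `f` correlates with its dual functions, then it correlates with approximations `g i j` of the
projections of the projections of `f`. -/
theorem le_norm_expect_expect_integral [Nonempty I] {f : X → ℂ} (hf : UnitBdd f) {D φ : I → X → ℂ}
    (hD : ∀ i, UnitBdd (D i)) (hφ : ∀ i, Measurable (φ i)) (hφ2 : ∀ i x, ‖φ i x‖ ≤ 2)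
    {g : I → I → X → ℂ} (hg : ∀ i j, Measurable (g i j)) (hg4 : ∀ i j x, ‖g i j x‖ ≤ 4)
    {a κ : ℝ} (hκa : κ ≤ a) (hκa2 : 2 * κ ≤ (a - κ) ^ 2)
    (h0 : a ≤ ‖𝔼 i, ∫ x, f x * D i x ∂μ‖)
    (h1 : ‖𝔼 i, ∫ x, (f x - φ i x) * D i x ∂μ‖ ≤ κ)
    (h2 : ‖𝔼 i, ∫ x, (f x - φ i x) * (starRingEnd ℂ) (1 / 2 * φ i x) ∂μ‖ ≤ κ)
    (h3 : ∀ i j, ‖∫ x, φ i x * (starRingEnd ℂ) (φ j x - g i j x) ∂μ‖ ≤ κ)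
    (h4 : ‖𝔼 i, ∫ x, (f x - φ i x) * (starRingEnd ℂ) (1 / 4 * 𝔼 j, g i j x) ∂μ‖ ≤ κ) :
    ((a - κ) ^ 2 - 2 * κ) ^ 2 - 5 * κ ≤
      ‖𝔼 i, 𝔼 j, ∫ x, f x * (starRingEnd ℂ) (g i j x) ∂μ‖ := by
  have hφ1 : ∀ i, UnitBdd fun x => 1 / 2 * φ i x := fun i =>
    ⟨(hφ i).const_mul _, fun x => by
      rw [norm_mul]
      norm_num
      linarith [hφ2 i x]⟩
  have hg1 : ∀ i j, UnitBdd fun x => 1 / 4 * g i j x := fun i j =>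
    ⟨(hg i j).const_mul _, fun x => by
      rw [norm_mul]
      norm_num
      linarith [hg4 i j x]⟩
  -- the family `φ` has large energy
  rw [expect_integral_sub_mul hf hφ hφ2 (fun i => (hD i).measurable) fun i => (hD i).norm_le] at h1
  have i1 : a - κ ≤ ‖𝔼 i, ∫ x, φ i x * D i x ∂μ‖ := by
    have := norm_sub_norm_le (𝔼 i, ∫ x, f x * D i x ∂μ) (𝔼 i, ∫ x, φ i x * D i x ∂μ)
    linarith
  have i2 := norm_expect_integral_sq_le (μ := μ) (S := Unit) (T := I) (b := D)
    (Z := fun _ i x => 1 / 2 * φ i x) hD fun _ i => hφ1 i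
  simp only [Finset.univ_unique, Finset.expect_singleton] at i2
  have e1 : 𝔼 i, ∫ x, D i x * (1 / 2 * φ i x) ∂μ = 1 / 2 * 𝔼 i, ∫ x, φ i x * D i x ∂μ := by
    rw [Finset.mul_expect]
    refine Finset.expect_congr rfl fun i _ => ?_
    rw [← integral_const_mul]
    congr 1
    funext x
    ring
  have e2 : 𝔼 i, ∫ x, 1 / 2 * φ i x * (starRingEnd ℂ) (1 / 2 * φ i x) ∂μ =
      1 / 2 * 𝔼 i, ∫ x, φ i x * (starRingEnd ℂ) (1 / 2 * φ i x) ∂μ := by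
    rw [Finset.mul_expect]
    refine Finset.expect_congr rfl fun i _ => ?_
    rw [← integral_const_mul]
    congr 1
    funext x
    ring
  rw [e1, e2, norm_mul, norm_mul, mul_pow] at i2
  norm_num at i2
  have i3 : (a - κ) ^ 2 ≤ 2 * ‖𝔼 i, ∫ x, φ i x * (starRingEnd ℂ) (1 / 2 * φ i x) ∂μ‖ := by
    have := pow_le_pow_left₀ (by linarith) i1 2
    norm_num
    linarith
  -- `f` correlates with `φ`
  rw [expect_integral_sub_mul hf hφ hφ2 (fun i => (hφ1 i).conj.measurable)
    fun i => (hφ1 i).conj.norm_le] at h2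
  have i4 : ((a - κ) ^ 2 - 2 * κ) / 2 ≤
      ‖𝔼 i, ∫ x, f x * (starRingEnd ℂ) (1 / 2 * φ i x) ∂μ‖ := by
    have := norm_sub_norm_le (𝔼 i, ∫ x, φ i x * (starRingEnd ℂ) (1 / 2 * φ i x) ∂μ)
      (𝔼 i, ∫ x, f x * (starRingEnd ℂ) (1 / 2 * φ i x) ∂μ)
    rw [norm_sub_rev] at this
    linarith
  -- the members of `φ` correlate with one another
  have i5 := norm_expect_integral_sq_le (μ := μ) (S := I) (T := Unit) (b := fun _ => f)
    (Z := fun i _ x => (starRingEnd ℂ) (1 / 2 * φ i x)) (fun _ => hf) fun i _ => (hφ1 i).conj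
  simp only [Finset.univ_unique, Finset.expect_singleton] at i5
  have e3 : 𝔼 i, 𝔼 j, ∫ x, (starRingEnd ℂ) (1 / 2 * φ i x) *
      (starRingEnd ℂ) ((starRingEnd ℂ) (1 / 2 * φ j x)) ∂μ =
      1 / 4 * 𝔼 i, 𝔼 j, ∫ x, φ i x * (starRingEnd ℂ) (φ j x) ∂μ := by
    rw [Finset.expect_comm, Finset.mul_expect]
    refine Finset.expect_congr rfl fun i _ => ?_
    rw [Finset.mul_expect]
    refine Finset.expect_congr rfl fun j _ => ?_
    rw [← integral_const_mul]
    congr 1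
    funext x
    simp only [map_mul, Complex.conj_conj, map_div₀, map_one, map_ofNat]
    ring
  rw [e3, norm_mul] at i5
  norm_num at i5
  have i6 : ((a - κ) ^ 2 - 2 * κ) ^ 2 ≤ ‖𝔼 i, 𝔼 j, ∫ x, φ i x * (starRingEnd ℂ) (φ j x) ∂μ‖ := by
    have := pow_le_pow_left₀ (by linarith) i4 2
    norm_num at this
    linarith
  -- replacing one of them by its approximation
  have i7 : ‖(𝔼 i, 𝔼 j, ∫ x, φ i x * (starRingEnd ℂ) (φ j x) ∂μ) -
      𝔼 i, 𝔼 j, ∫ x, φ i x * (starRingEnd ℂ) (g i j x) ∂μ‖ ≤ κ := by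
    have hκ : 0 ≤ κ := (norm_nonneg _).trans h1
    rw [← Finset.expect_sub_distrib]
    refine norm_expect_le_of_le _ hκ fun i => ?_
    rw [← Finset.expect_sub_distrib]
    refine norm_expect_le_of_le _ hκ fun j => ?_
    rw [← integral_sub (integrable_mul_of_bounded (hφ i) (measurable_conj (hφ j)) (hφ2 i)
      (b := 2) fun x => by rw [RCLike.norm_conj]; exact hφ2 j x)
      (integrable_mul_of_bounded (hφ i) (measurable_conj (hg i j)) (hφ2 i)
      (b := 4) fun x => by rw [RCLike.norm_conj]; exact hg4 i j x)]
    simpa only [map_sub, mul_sub] using h3 i j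
  -- Replacing `φ i` by `f` against the average of `g i j` over `j` costs `4 * κ`, because of the
  -- factor `1 / 4`; with the `κ` of `i7` this is the loss `5 * κ`.
  rw [expect_integral_sub_mul hf hφ hφ2 (b := 1)] at h4
  · have e4 : ∀ F : I → X → ℂ, (∀ i, Measurable (F i)) → (∀ i x, ‖F i x‖ ≤ 2) →
        𝔼 i, ∫ x, F i x * (starRingEnd ℂ) (1 / 4 * 𝔼 j, g i j x) ∂μ =
        1 / 4 * 𝔼 i, 𝔼 j, ∫ x, F i x * (starRingEnd ℂ) (g i j x) ∂μ := by
      intro F hF hF2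
      rw [Finset.mul_expect]
      refine Finset.expect_congr rfl fun i _ => ?_
      rw [← integral_expect, ← integral_const_mul]
      · congr 1
        funext x
        rw [← Finset.mul_expect, ← conj_expect, map_mul]
        simp only [map_div₀, map_one, map_ofNat]
        ring
      · exact fun j => integrable_mul_of_bounded (hF i) (measurable_conj (hg i j)) (hF2 i)
          (b := 4) fun x => by rw [RCLike.norm_conj]; exact hg4 i j x
    rw [e4 _ (fun _ => hf.measurable) fun _ x => (hf.norm_le x).trans one_le_two,
      e4 _ hφ hφ2, ← mul_sub, norm_mul] at h4
    norm_num at h4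
    have := norm_sub_norm_le (𝔼 i, 𝔼 j, ∫ x, φ i x * (starRingEnd ℂ) (φ j x) ∂μ)
      (𝔼 i, 𝔼 j, ∫ x, φ i x * (starRingEnd ℂ) (g i j x) ∂μ)
    have := norm_sub_norm_le (𝔼 i, 𝔼 j, ∫ x, φ i x * (starRingEnd ℂ) (g i j x) ∂μ)
      (𝔼 i, 𝔼 j, ∫ x, f x * (starRingEnd ℂ) (g i j x) ∂μ)
    rw [norm_sub_rev] at this
    linarith
  all_goals
    have hu : ∀ i, UnitBdd fun x => 1 / 4 * 𝔼 j, g i j x := fun i => by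
      simpa only [Finset.mul_expect] using UnitBdd.expect fun j => hg1 i j
  · exact fun i => (hu i).conj.measurable
  · exact fun i => (hu i).conj.norm_le

end Core

/-! ### Elementary properties of box norms -/

section BoxNorm

variable {G X : Type*} [AddCommGroup G] [AddAction G X] [MeasurableSpace X] {μ : Measure X}

theorem boxAvg_congr_ae (hμ : IsGSystem G μ) (Qs : List (Multiset G)) {f g : X → ℂ}
    (h : f =ᵐ[μ] g) : boxAvg μ Qs f = boxAvg μ Qs g := by
  induction Qs generalizing f g with
  | nil => exact integral_congr_ae h
  | cons Q Qs ih =>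
    have hs : ∀ a : G, shift a f =ᵐ[μ] shift a g := fun a =>
      (hμ.measurePreserving (-a)).quasiMeasurePreserving.ae_eq_comp h
    have hd : ∀ a a' : G, gowersDelta a a' f =ᵐ[μ] gowersDelta a a' g := by
      intro a a'
      filter_upwards [hs a, hs a'] with x h1 h2
      simp only [gowersDelta, h1, h2]
    simp only [boxAvg, ih (hd _ _)]

theorem boxNorm_congr_ae (hμ : IsGSystem G μ) (Qs : List (Multiset G)) {f g : X → ℂ}
    (h : f =ᵐ[μ] g) : boxNorm μ Qs f = boxNorm μ Qs g := by
  rw [boxNorm, boxNorm, boxAvg_congr_ae hμ Qs h]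

theorem UnitBdd.boxNorm_le_one (hμ : IsGSystem G μ) (Qs : List (Multiset G)) {f : X → ℂ}
    (hf : UnitBdd f) : boxNorm μ Qs f ≤ 1 := by
  have := hμ.isProbabilityMeasure
  refine Real.rpow_le_one (norm_nonneg _) ?_ (by positivity)
  induction Qs generalizing f with
  | nil => exact hf.norm_integral_le μ
  | cons Q Qs ih =>
    exact norm_multisetAvg_le _ _ zero_le_one fun a _ => norm_multisetAvg_le _ _ zero_le_one
      fun a' _ => ih (hf.gowersDelta hμ a a')

theorem exists_unitBdd_ae_eq {f : X → ℂ} (hf : AEStronglyMeasurable f μ)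
    (hf1 : eLpNorm f ⊤ μ ≤ 1) : ∃ f' : X → ℂ, UnitBdd f' ∧ f =ᵐ[μ] f' := by
  classical
  have hm := hf.stronglyMeasurable_mk.measurable
  refine ⟨fun x => if ‖hf.mk f x‖ ≤ 1 then hf.mk f x else 0, ⟨?_, fun x => ?_⟩, ?_⟩
  · exact Measurable.ite (measurableSet_le hm.norm measurable_const) hm measurable_const
  · split_ifs with h
    · exact h
    · simp
  · have h1 : ∀ᵐ x ∂μ, ‖f x‖ ≤ 1 := by
      rw [eLpNorm_exponent_top] at hf1
      filter_upwards [ae_le_eLpNormEssSup (f := f) (μ := μ)] with x hx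
      have := hx.trans hf1
      rwa [← ofReal_norm, ENNReal.ofReal_le_one] at this
    filter_upwards [h1, hf.ae_eq_mk] with x hx hx'
    rw [← hx', if_pos hx]

/-- Each integral is the `2 ^ d`-th power of a box norm, so convexity of the power gives the bound.
For `d = 0` the box average need not be a non-negative real. -/
theorem le_norm_expect_boxAvg {I : Type*} [Fintype I] [Nonempty I] (hμ : IsGSystem G μ) {d : ℕ}
    (hd : 0 < d) (A : I → Fin d → Multiset G) {f : X → ℂ} (hf : UnitBdd f) :
    (𝔼 i, boxNorm μ (List.ofFn (A i)) f) ^ 2 ^ d ≤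
      ‖𝔼 i, ∫ x, f x * boxDual (A i) f x ∂μ‖ := by
  have hne : ∀ i, List.ofFn (A i) ≠ [] := fun i h => by
    have := congrArg List.length h
    simp at this
    omega
  have h0 : ∀ i, 0 ≤ boxNorm μ (List.ofFn (A i)) f := fun i => by
    rw [boxNorm]; positivity
  have e : 𝔼 i, ∫ x, f x * boxDual (A i) f x ∂μ =
      ((𝔼 i, boxNorm μ (List.ofFn (A i)) f ^ 2 ^ d : ℝ) : ℂ) := by
    rw [ofReal_expect]
    refine Finset.expect_congr rfl fun i _ => ?_
    rw [← boxAvg_eq_integral_mul_boxDual hμ _ hf, ← hμ.boxNorm_pow _ (hne i) (hf.memLp μ)]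
    simp
  rw [e, Complex.norm_real, Real.norm_of_nonneg (Finset.expect_nonneg fun i _ => pow_nonneg (h0 i) _)]
  exact expect_pow_le_expect_pow _ h0 _

end BoxNorm

/-! ### Choice of parameters and conclusion -/

section Main

universe u v w

/-- Structure along the sums at a scale `s ≥ ε` persists at scale `ε`; after the pairs `(k, l)` are
numbered in the order of the flattened list, `IsStr.norm_integral_mul_le` applies. -/
theorem IsStr.norm_integral_mul_conj_le {G X : Type*} [AddCommGroup G] [AddAction G X]
    [MeasurableSpace X] {μ : Measure X} (hμ : IsGSystem G μ) {d : ℕ}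
    {Q Q' : Fin d → CosetProgression G} {s τ ε M : ℝ} (hε : 0 ≤ ε) (hεs : ε ≤ s) (hτ : 0 ≤ τ)
    {g f : X → ℂ} (hg : IsStr (dilateAddSet Q Q' s) τ M g) (hf : UnitBdd f) :
    ‖∫ x, f x * (starRingEnd ℂ) (g x) ∂μ‖ ≤ M * (boxNorm μ (List.ofFn fun k => List.ofFn fun l =>
      sumset ((Q k).dilate ε) ((Q' l).dilate ε)).flatten f + τ) := by
  let A : Fin (d * d) → Multiset G := fun p =>
    sumset ((Q (finProdFinEquiv.symm p).1).dilate ε) ((Q' (finProdFinEquiv.symm p).2).dilate ε)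
  have hA : (List.ofFn fun k => List.ofFn fun l =>
      sumset ((Q k).dilate ε) ((Q' l).dilate ε)).flatten = List.ofFn A := by
    rw [List.ofFn_mul]
    congr! 6 with i j
    all_goals
      have : ∀ h, (⟨i * d + j, h⟩ : Fin (d * d)) = finProdFinEquiv (i, j) := fun h =>
        Fin.ext (by simp [finProdFinEquiv, mul_comm, add_comm])
      rw [this, Equiv.symm_apply_apply]
  rw [hA]
  refine ((hg.mono (dilateAddSet_mono Q Q' hεs) hτ le_rfl).conj.reindex
    finProdFinEquiv).norm_integral_mul_le hμ hf (fun p => ?_) (fun p a ha => ha) hτ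
  intro h
  have : (0 : G) + 0 ∈ A p := mem_sumset.2 ⟨0, (Q _).zero_mem_dilate hε, 0,
    (Q' _).zero_mem_dilate hε, rfl⟩
  simp [h] at this

/-- The Bessel argument by contradiction: a large average over `i` forces the average correlation of
`f` with `g i j` to be at least `a ^ 4 / 2`, whereas the hypothesis bounds it by `P (K m) * (ε +
τ)`. -/
theorem exists_threshold (d : ℕ) (hd : 0 < d) (r : ℕ) {η : ℝ} (hη : 0 < η) (hη1 : η ≤ 1) :
    ∃ ε₀ : ℝ, 0 < ε₀ ∧ ∀ {I : Type u} [Fintype I] [Nonempty I] {G : Type v} [AddCommGroup G]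
      {X : Type w} [MeasurableSpace X] [AddAction G X] (μ : Measure X), IsGSystem G μ →
      ∀ Q : I → Fin d → CosetProgression G, (∀ i k, (Q i k).rank ≤ r) → ∀ f : X → ℂ, UnitBdd f →
      ∀ ε : ℝ, 0 < ε → ε ≤ ε₀ →
        (𝔼 i, 𝔼 j, boxNorm μ (List.ofFn fun k => List.ofFn fun l =>
          sumset ((Q i k).dilate ε) ((Q j l).dilate ε)).flatten f) ≤ ε →
        (𝔼 i, boxNorm μ (List.ofFn fun k => (Q i k).toMultiset) f) ≤ η := by
  set a := η ^ 2 ^ d with ha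
  have ha0 : 0 < a := by positivity
  have ha1 : a ≤ 1 := pow_le_one₀ hη.le hη1
  set κ := a ^ 4 / 1000 with hκ
  have hκ0 : 0 < κ := by positivity
  have hκ1 : κ ≤ 1 := by
    have := pow_le_one₀ ha0.le ha1 (n := 4)
    rw [hκ]; linarith
  choose P T hP hT hPT using fun M => exists_approx_of_isStr.{v, w} d r hκ0 M
  obtain ⟨N, K, hK, hmain⟩ := exists_bounded_approx.{u, w}
    (fun M => |M| + |dualBound d r 1| + P M) hκ0 hκ1
  obtain ⟨τ₀, hτ₀, hτ₀1, hτ₀T⟩ : ∃ τ₀ : ℝ, 0 < τ₀ ∧ τ₀ ≤ 1 ∧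
      ∀ m ∈ Finset.range N, τ₀ ≤ T (K m) ∧ 2 * P (K m) * τ₀ < a ^ 4 / 2 := by
    have h1 : ∀ m ∈ Finset.range N, ∀ᶠ τ in 𝓝[>] (0 : ℝ),
        τ ≤ T (K m) ∧ 2 * P (K m) * τ < a ^ 4 / 2 := by
      intro m _
      have hc : Tendsto (fun τ : ℝ => 2 * P (K m) * τ) (𝓝[>] 0) (𝓝 0) := by
        have : Tendsto (fun τ : ℝ => 2 * P (K m) * τ) (𝓝 0) (𝓝 (2 * P (K m) * 0)) :=
          (continuous_const.mul continuous_id).tendsto 0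
        rw [mul_zero] at this
        exact this.mono_left nhdsWithin_le_nhds
      have h2 : ∀ᶠ τ in 𝓝[>] (0 : ℝ), τ ≤ T (K m) :=
        nhdsWithin_le_nhds (Iic_mem_nhds (hT _))
      exact h2.and (hc.eventually_lt_const (by positivity))
    have h2 := (Filter.eventually_all_finset _).2 h1
    have h3 : ∀ᶠ τ in 𝓝[>] (0 : ℝ), τ ≤ 1 := nhdsWithin_le_nhds (Iic_mem_nhds one_pos)
    obtain ⟨τ, ⟨h4, h5⟩, h6⟩ := ((h2.and h3).and self_mem_nhdsWithin).exists
    exact ⟨τ, h6, h5, h4⟩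
  -- For `τ = ε ^ (1 / (N + 1))` this gives `τ ≤ τ₀`, and every scale `τ ^ (m + 1)` with `m < N` is
  -- at least `ε`.
  refine ⟨τ₀ ^ (N + 1), by positivity, ?_⟩
  intro I _ _ G _ X _ _ μ hμ Q hQ f hf ε hε hεε₀ hsmall
  have := hμ.isProbabilityMeasure
  by_contra! hlarge
  -- the ratio of consecutive scales
  obtain ⟨τ, hτ, hττ₀, hτε⟩ : ∃ τ : ℝ, 0 < τ ∧ τ ≤ τ₀ ∧ τ ^ (N + 1) = ε := by
    have h := Real.rpow_inv_natCast_pow hε.le (Nat.succ_ne_zero N)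
    refine ⟨ε ^ ((N + 1 : ℕ) : ℝ)⁻¹, by positivity, ?_, h⟩
    by_contra! hlt
    have := pow_lt_pow_left₀ hlt hτ₀.le (Nat.succ_ne_zero N)
    rw [h] at this
    exact (this.trans_le hεε₀).false
  have hτ1 : τ ≤ 1 := hττ₀.trans hτ₀1
  have hpow : ∀ {m n : ℕ}, m ≤ n → τ ^ n ≤ τ ^ m := fun h => pow_le_pow_of_le_one hτ.le hτ1 h
  obtain ⟨m, hm, φ, hφ, hφ2, horth⟩ := hmain μ
    (fun m M (φ : I → X → ℂ) => ∀ i, IsStr (dilateSet (Q i) (τ ^ m)) τ M (φ i))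
    (fun m => isComplexityClass_isStr hτ.le hτ1 _)
    (fun m M φ h i => (h i).mono (dilateSet_mono _ (hpow m.le_succ)) hτ.le le_rfl)
    (fun i => IsStr.zero hτ.le le_rfl) (fun _ => f) (fun _ => hf)
  obtain ⟨hτT, hτP⟩ := hτ₀T m (Finset.mem_range.2 hm)
  have hg := fun i j => hPT (K m) μ hμ (hQ i) hτ hτ1 (hττ₀.trans hτT) (pow_pos hτ m) (hφ i) (hφ j)
    (hφ2 j) (Q' := Q j)
  choose g hg1 hg2 hg4 hgφ using hg
  rw [← pow_succ'] at hg1 hg2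
  have hΦ : 0 ≤ |K m| ∧ 0 ≤ |dualBound d r 1| ∧ 0 ≤ P (K m) :=
    ⟨abs_nonneg _, abs_nonneg _, hP _⟩
  let D : I → X → ℂ := fun i => boxDual (fun k => (Q i k).toMultiset) f
  have hD : ∀ i, UnitBdd (D i) := fun i => hf.boxDual hμ _
  have h1 : ‖𝔼 i, ∫ x, (f x - φ i x) * D i x ∂μ‖ ≤ κ := by
    have := horth (fun i x => (starRingEnd ℂ) (D i x)) (fun i => ?_) fun i => (hD i).conj.norm_le
    · simpa only [Complex.conj_conj] using this
    -- The undilated progressions have scale `1`, so `D i` is structured at scale `τ`, and a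
    -- fortiori at `τ ^ (m + 1)`.
    · have := hf.isStr_boxDual_dilate hμ hτ.le hτ1 one_pos (hQ i)
      simp only [CosetProgression.dilate_one] at this
      refine this.conj.mono (dilateSet_mono _ ?_) hτ.le ?_
      · simpa using hpow (Nat.le_add_left 1 m)
      · linarith [le_abs_self (dualBound d r 1)]
  have h2 : ‖𝔼 i, ∫ x, (f x - φ i x) * (starRingEnd ℂ) (1 / 2 * φ i x) ∂μ‖ ≤ κ := by
    refine horth (fun i x => 1 / 2 * φ i x) (fun i => ?_) fun i x => ?_
    · refine ((hφ i).smul (1 / 2)).mono (dilateSet_mono _ (hpow m.le_succ)) hτ.le ?_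
      norm_num
      linarith [le_abs_self (K m)]
    · rw [norm_mul]
      norm_num
      linarith [hφ2 i x]
  -- Here `g i j` must be structured along `Q i` alone: only this structure is common to all `j` and
  -- survives the average.
  have h4 : ‖𝔼 i, ∫ x, (f x - φ i x) * (starRingEnd ℂ) (1 / 4 * 𝔼 j, g i j x) ∂μ‖ ≤ κ := by
    refine horth (fun i x => 1 / 4 * 𝔼 j, g i j x) (fun i => ?_) fun i x => ?_
    · refine ((IsStr.expect fun j => hg1 i j).smul (1 / 4)).mono (fun _ => subset_rfl) hτ.le ?_
      norm_num
      linarith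
    · rw [norm_mul]
      norm_num
      linarith [norm_expect_le_of_le (fun j => g i j x) (by norm_num : (0 : ℝ) ≤ 4)
        fun j => hg4 i j x]
  have h0 : a ≤ ‖𝔼 i, ∫ x, f x * D i x ∂μ‖ :=
    (pow_le_pow_left₀ hη.le hlarge.le _).trans
      (le_norm_expect_boxAvg hμ hd (fun i k => (Q i k).toMultiset) hf)
  have ha4 : a ^ 4 ≤ a ^ 2 := pow_le_pow_of_le_one ha0.le ha1 (by norm_num)
  have ha2 : a ^ 2 ≤ a := by nlinarith
  have hκa : 999 / 1000 * a ≤ a - κ := by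
    rw [hκ]; linarith
  have hκ2 : 99 / 100 * a ^ 2 ≤ (a - κ) ^ 2 - 2 * κ := by
    have := pow_le_pow_left₀ (by positivity) hκa 2
    rw [mul_pow] at this
    norm_num at this
    linarith
  have hκ4 : a ^ 4 / 2 ≤ ((a - κ) ^ 2 - 2 * κ) ^ 2 - 5 * κ := by
    have := pow_le_pow_left₀ (by positivity) hκ2 2
    have e : (99 / 100 * a ^ 2) ^ 2 = 9801 / 10000 * a ^ 4 := by ring
    rw [e] at this
    have : 0 ≤ a ^ 4 := by positivity
    linarith
  have hlow := le_norm_expect_expect_integral hf hD (fun i => (hφ i).measurable) hφ2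
    (fun i j => (hg1 i j).measurable) hg4 (by linarith) (by nlinarith) h0 h1 h2 hgφ h4
  have hup : ‖𝔼 i, 𝔼 j, ∫ x, f x * (starRingEnd ℂ) (g i j x) ∂μ‖ ≤ P (K m) * (ε + τ) := by
    refine (norm_expect_le _ _).trans ((Finset.expect_le_expect fun i _ =>
      (norm_expect_le _ _).trans (Finset.expect_le_expect fun j _ =>
        (hg2 i j).norm_integral_mul_conj_le hμ hε.le (hτε ▸ hpow (by omega)) hτ.le hf)).trans ?_)
    simp only [← Finset.mul_expect, Finset.expect_add_distrib, Fintype.expect_const]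
    exact mul_le_mul_of_nonneg_left (by linarith) (hP _)
  have hετ : ε ≤ τ := by
    rw [← hτε]
    simpa using hpow (Nat.le_add_left 1 N)
  have : P (K m) * (ε + τ) ≤ P (K m) * (2 * τ₀) :=
    mul_le_mul_of_nonneg_left (by linarith) (hP _)
  linarith

/-- The modulus is `ε` plus the supremum of the values attained at `ε`. The term `ε` makes it
positive, and inserting `0` keeps the set non-empty and the supremum non-negative. -/
theorem exists_modulus {P : ℝ → ℝ → Prop} (hb : ∀ ε t, P ε t → t ≤ 1)
    (h : ∀ η : ℝ, 0 < η → η ≤ 1 → ∃ ε₀ : ℝ, 0 < ε₀ ∧ ∀ ε, 0 < ε → ε ≤ ε₀ → ∀ t, P ε t → t ≤ η) :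
    ∃ c : ℝ → ℝ, (∀ ε, 0 < ε → 0 < c ε) ∧ Tendsto c (𝓝[>] 0) (𝓝 0) ∧
      ∀ ε, 0 < ε → ∀ t, P ε t → t ≤ c ε := by
  have hbdd : ∀ ε, BddAbove (insert 0 {t | P ε t}) := fun ε =>
    ⟨1, by rintro t (rfl | ht); exacts [zero_le_one, hb ε t ht]⟩
  have h0 : ∀ ε, 0 ≤ sSup (insert 0 {t | P ε t}) := fun ε =>
    le_csSup (hbdd ε) (Set.mem_insert _ _)
  refine ⟨fun ε => ε + sSup (insert 0 {t | P ε t}), fun ε hε => by linarith [h0 ε], ?_,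
    fun ε hε t ht => ?_⟩
  · rw [Metric.tendsto_nhdsWithin_nhds]
    intro η hη
    obtain ⟨ε₀, hε₀, hε⟩ := h (min 1 (η / 2)) (by positivity) (min_le_left _ _)
    refine ⟨min ε₀ (η / 2), by positivity, fun ε hε0 hεd => ?_⟩
    rw [Set.mem_Ioi] at hε0
    rw [Real.dist_eq, sub_zero, abs_of_pos hε0, lt_min_iff] at hεd
    have : sSup (insert 0 {t | P ε t}) ≤ η / 2 := by
      refine csSup_le (Set.insert_nonempty _ _) ?_
      rintro t (rfl | ht)
      · positivity
      · exact (hε ε hε0 hεd.1.le t ht).trans (min_le_right _ _)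
    rw [Real.dist_eq, sub_zero, abs_of_nonneg (by linarith [h0 ε])]
    linarith [hεd.2]
  · have := le_csSup (hbdd ε) (Set.mem_insert_of_mem _ ht)
    linarith

end Main

end

/-- Qualitative Bessel inequality for box norms. -/
theorem theorem1p17 (d : ℕ) (hd : 0 < d) (r : ℕ) :
    ∃ c : ℝ → ℝ, (∀ ε : ℝ, 0 < ε → 0 < c ε) ∧ Tendsto c (𝓝[>] 0) (𝓝 0) ∧
      ∀ {I : Type*} [Fintype I] [Nonempty I]
        {G : Type*} [AddCommGroup G] [Countable G]
        {X : Type*} [MeasurableSpace X] [AddAction G X]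
        (μ : Measure X) (_ : IsGSystem G μ)
        (Q : I → Fin d → CosetProgression G) (_ : ∀ i k, (Q i k).rank ≤ r)
        (f : X → ℂ) (_ : AEStronglyMeasurable f μ) (_ : eLpNorm f ⊤ μ ≤ 1)
        (ε : ℝ) (_ : 0 < ε),
        (𝔼 i, 𝔼 j, boxNorm μ
          (List.ofFn fun k => List.ofFn fun l =>
            sumset ((Q i k).dilate ε) ((Q j l).dilate ε)).flatten f) ≤ ε →
        (𝔼 i, boxNorm μ (List.ofFn fun k => (Q i k).toMultiset) f) ≤ c ε := by
  -- Quantifying over all systems inside `P` makes the modulus depend on `d` and `r` only.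
  let P : ℝ → ℝ → Prop := fun ε t =>
    ∃ (I : Type u_1) (_ : Fintype I) (_ : Nonempty I) (G : Type u_2) (_ : AddCommGroup G)
      (X : Type u_3) (_ : MeasurableSpace X) (_ : AddAction G X) (μ : Measure X)
      (_ : IsGSystem G μ) (Q : I → Fin d → CosetProgression G) (_ : ∀ i k, (Q i k).rank ≤ r)
      (f : X → ℂ) (_ : UnitBdd f),
      (𝔼 i, 𝔼 j, boxNorm μ
          (List.ofFn fun k => List.ofFn fun l =>
            sumset ((Q i k).dilate ε) ((Q j l).dilate ε)).flatten f) ≤ ε ∧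
        t = 𝔼 i, boxNorm μ (List.ofFn fun k => (Q i k).toMultiset) f
  have hP1 : ∀ ε t, P ε t → t ≤ 1 := by
    rintro ε t ⟨I, _, _, G, _, X, _, _, μ, hμ, Q, hQ, f, hf, -, rfl⟩
    exact Finset.expect_le Finset.univ_nonempty fun i _ => hf.boxNorm_le_one hμ _
  obtain ⟨c, hc, hlim, h⟩ := exists_modulus hP1 fun η hη hη1 => by
    obtain ⟨ε₀, hε₀, h⟩ := exists_threshold d hd r hη hη1
    refine ⟨ε₀, hε₀, ?_⟩
    rintro ε hε hεε₀ t ⟨I, _, _, G, _, X, _, _, μ, hμ, Q, hQ, f, hf, hs, rfl⟩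
    exact h μ hμ Q hQ f hf ε hε hεε₀ hs
  refine ⟨c, hc, hlim, ?_⟩
  intro I _ _ G _ _ X _ _ μ hμ Q hQ f hf hf1 ε hε hsmall
  -- Structure is a pointwise notion, so `f` is first replaced by an everywhere bounded measurable
  -- representative; box norms do not see the difference.
  obtain ⟨f', hf', hff'⟩ := exists_unitBdd_ae_eq hf hf1
  simp only [boxNorm_congr_ae hμ _ hff'] at hsmall ⊢
  exact h ε hε _ ⟨I, _, ‹_›, G, _, X, _, _, μ, hμ, Q, hQ, f', hf', hsmall, rfl⟩
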